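/- Let $s \ge 2$, let $d_1,\dots,d_s$ be integers with every $d_i > 1$, and put $d=\prod_{i=1}^s d_i$. For a prime $p$ let $h=\sum_{i=1}^s x_i^{d_i}$ in $A=(\mathbb{Z}/p)[x_1,\dots,x_s]$, and for $n\ge 0$ let $e_n(h)$ be the length of $A/(h,x_1^{q},\dots,x_s^{q})$, where $q=p^n$. The lengths $e_n(h)$ are finite, and there is a unique real number $\mu=\mu_p>0$, the Hilbert-Kunz multiplicity of $h$, such that $e_n(h)=\mu q^{s-1}+O(q^{s-2})$ as $n\to\infty$ with $p$ fixed. For $\lambda\in\mathbb{Z}$ let $$C_\lambda=\sum_{\epsilon}(\epsilon_1\cdots\epsilon_s)\left(\frac{\epsilon_1}{d_1}+\cdots+\frac{\epsilon_s}{d_s}-2\lambda\right)^{s-1},$$ where the sum extends over the $\epsilon\in\{-1,1\}^s$ with $\frac{\epsilon_1}{d_1}+\cdots+\frac{\epsilon_s}{d_s}>2\lambda$. Then $C_\lambda=0$ for all but finitely many $\lambda\in\mathbb{Z}$, and as $p\to\infty$ through the primes, $$\mu_p\;\longrightarrow\;\frac{d\,2^{1-s}}{(s-1)!}\sum_{\lambda\in\mathbb{Z}}C_\lambda=\frac{d\,2^{1-s}}{(s-1)!}\Bigl(C_0+2\sum_{\lambda>0}C_\lambda\Bigr).$$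 -/

import Mathlib

/-- The element `∑ x_i ^ d_i` of `(ℤ/p)[x_1, …, x_s]`. -/
noncomputable def diagonalForm (p : ℕ) {s : ℕ} (d : Fin s → ℕ) : MvPolynomial (Fin s) (ZMod p) :=
  ∑ i, MvPolynomial.X i ^ d i

/-- The colength `e_n(f)`: the length of `A / (f, x_1 ^ q, …, x_s ^ q)`, where
`A = (ℤ/p)[x_1, …, x_s]` and `q = p ^ n`. -/
noncomputable def hkColength {p s : ℕ} (f : MvPolynomial (Fin s) (ZMod p)) (n : ℕ) : ℕ∞ :=
  Module.length (MvPolynomial (Fin s) (ZMod p))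
    (MvPolynomial (Fin s) (ZMod p) ⧸
      Ideal.span (insert f (Set.range fun i : Fin s => MvPolynomial.X i ^ (p ^ n))))

/-- `μ` is the Hilbert-Kunz multiplicity of `f`: it is positive, all the colengths `e_n` are finite,
and `e_n = μ q ^ (s - 1) + O(q ^ (s - 2))` with `q = p ^ n`, as `n → ∞`. (For `s ≥ 2`.) -/
def IsHilbertKunzMultiplicity {p s : ℕ} (f : MvPolynomial (Fin s) (ZMod p)) (μ : ℝ) : Prop :=
  0 < μ ∧ ∃ e : ℕ → ℕ, (∀ n, hkColength f n = (e n : ℕ∞)) ∧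
    Asymptotics.IsBigO Filter.atTop
      (fun n : ℕ => (e n : ℝ) - μ * ((p : ℝ) ^ n) ^ (s - 1))
      (fun n : ℕ => ((p : ℝ) ^ n) ^ (s - 2))

/-- `C_l = ∑ (ε_1 ⋯ ε_s) (ε_1 / d_1 + ⋯ + ε_s / d_s - 2 l) ^ (s - 1)`, over the sign vectors `ε` with
`ε_1 / d_1 + ⋯ + ε_s / d_s > 2 l`. -/
noncomputable def signSum {s : ℕ} (d : Fin s → ℕ) (l : ℤ) : ℝ :=
  ∑ ε : Fin s → ℤˣ with 2 * (l : ℝ) < ∑ i, ((ε i : ℤ) : ℝ) / (d i : ℝ),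
    (∏ i, ((ε i : ℤ) : ℝ)) * ((∑ i, ((ε i : ℤ) : ℝ) / (d i : ℝ)) - 2 * (l : ℝ)) ^ (s - 1)

/-!
Splitting exponents into residue classes modulo the `d i` turns multiplication by `∑ X i ^ d i` into
copies of multiplication by the linear form `∑ X i`. With Macaulay duality, `e_n` becomes a sum of
`∏ d i` colengths of `∑ X i`, for exponents which differ from `⌊q / d i⌋` by at most `1`. The
colength of `∑ X i` for the exponents `a` is the dimension of the kernel of a tensor sum of
nilpotent Jordan blocks of sizes `a i`. It varies in a Lipschitz way with `a` and, by Frobenius, it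
gets multiplied by `p ^ (s - 1)` when `a` gets multiplied by `p`; so `μ_p` exists and equals
`(∏ d i) * colength (⌊p / d i⌋) / p ^ (s - 1)` up to `O(1 / p)`.

When all `a i ≤ p`, the colength is the number of points of the box `a` whose coordinate sum is
congruent modulo `p` to the middle degree `⌊∑ (a i - 1) / 2⌋`. Indeed, the tensor product of Jordan
blocks of sizes `n + 1` and `2` has blocks of sizes `n + 2` and `n` if `n + 1` is invertible; this
makes the colength a solution of a discrete wave equation in any two of the `a i`, and the count
solves the same equation with the same boundary values. By inclusion and exclusion the count is an
alternating sum of binomial coefficients, whose asymptotics produces the sign sums `C_λ`.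
-/

namespace DiagonalHK

open Module

section KernelsOfPowers

variable {k V W : Type*} [Field k] [AddCommGroup V] [Module k V] [AddCommGroup W] [Module k W]

theorem finrank_ker_pow_succ_le [FiniteDimensional k V] (T : End k V) (c : ℕ) :
    finrank k (LinearMap.ker (T ^ (c + 1))) ≤
      finrank k (LinearMap.ker (T ^ c)) + finrank k (LinearMap.ker T) := by
  set L := (T ^ c).domRestrict (LinearMap.ker (T ^ (c + 1))) with hL
  have hrange : finrank k (LinearMap.range L) ≤ finrank k (LinearMap.ker T) := by
    refine Submodule.finrank_mono ?_
    rintro _ ⟨v, rfl⟩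
    rw [LinearMap.mem_ker, hL, LinearMap.domRestrict_apply, ← End.mul_apply, ← pow_succ']
    exact v.2
  have hker : finrank k (LinearMap.ker L) = finrank k (LinearMap.ker (T ^ c)) := by
    rw [hL, LinearMap.ker_domRestrict]
    exact (Submodule.comapSubtypeEquivOfLe
      ((LinearMap.iterateKer T).monotone c.le_succ)).finrank_eq
  have := L.finrank_range_add_finrank_ker
  omega

theorem finrank_ker_pow_add_le [FiniteDimensional k V] (T : End k V) (c e : ℕ) :
    finrank k (LinearMap.ker (T ^ (c + e))) ≤
      finrank k (LinearMap.ker (T ^ c)) + e * finrank k (LinearMap.ker T) := by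
  induction e with
  | zero => simp
  | succ e ih =>
    have := finrank_ker_pow_succ_le T (c + e)
    rw [← add_assoc, add_mul, one_mul]
    omega

theorem finrank_ker_eq_of_intertwine (e : V ≃ₗ[k] W) {T : End k V} {T' : End k W}
    (h : ∀ v, e (T v) = T' (e v)) :
    finrank k (LinearMap.ker T) = finrank k (LinearMap.ker T') := by
  have hker : LinearMap.ker T = (LinearMap.ker T').comap e.toLinearMap := by
    ext v
    simp [← h]
  rw [hker]
  exact (e.ofSubmodule' _).finrank_eq

theorem finrank_ker_pow_eq_of_intertwine (e : V ≃ₗ[k] W) {T : End k V} {T' : End k W}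
    (h : ∀ v, e (T v) = T' (e v)) (c : ℕ) :
    finrank k (LinearMap.ker (T ^ c)) = finrank k (LinearMap.ker (T' ^ c)) :=
  finrank_ker_eq_of_intertwine e fun v =>
    (LinearMap.congr_fun (Module.End.commute_pow_left_of_commute
      (LinearMap.ext fun v => (h v).symm : T' ∘ₗ e.toLinearMap = e.toLinearMap ∘ₗ T) c) v).symm

theorem finrank_ker_piMap_pow {κ : Type*} [Fintype κ] {U : κ → Type*} [∀ r, AddCommGroup (U r)]
    [∀ r, Module k (U r)] [∀ r, FiniteDimensional k (U r)] (T : ∀ r, End k (U r)) (c : ℕ) :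
    finrank k (LinearMap.ker ((LinearMap.piMap T : End k (∀ r, U r)) ^ c)) =
      ∑ r, finrank k (LinearMap.ker (T r ^ c)) := by
  have hpow : (LinearMap.piMap T : End k (∀ r, U r)) ^ c = LinearMap.piMap fun r => T r ^ c := by
    induction c with
    | zero => rfl
    | succ c ih => simp only [pow_succ, ih]; rfl
  rw [hpow, ← finrank_pi_fintype]
  exact LinearEquiv.finrank_eq
    { toFun f r := ⟨f.1 r, congrFun f.2 r⟩
      invFun f := ⟨fun r => (f r).1, funext fun r => (f r).2⟩
      map_add' _ _ := rfl
      map_smul' _ _ := rfl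
      left_inv _ := rfl
      right_inv _ := rfl }

end KernelsOfPowers

section JordanSum

variable {k V : Type*} [Field k] [AddCommGroup V] [Module k V]

variable (k V) in
/-- The sequences in `V` that vanish from the index `c` on: a model of `V ⊗ k[t] / (t ^ c)`, the
multiplication by `t` being dual to the shift of sequences. -/
def truncSeq (c : ℕ) : Submodule k (ℕ → V) where
  carrier := {f | ∀ n, c ≤ n → f n = 0}
  zero_mem' _ _ := rfl
  add_mem' hf hg n hn := by simp [hf n hn, hg n hn]
  smul_mem' a f hf n hn := by simp [hf n hn]

/-- The Kronecker sum of `T` with a nilpotent Jordan block of size `c`, acting on `truncSeq k V c`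
by applying `T` to each term and adding the shifted sequence. -/
def jordanSum (T : End k V) (c : ℕ) : End k (truncSeq k V c) :=
  (T.compLeft ℕ + LinearMap.funLeft k V Nat.succ).restrict fun f hf n hn => by
    simp [LinearMap.funLeft_apply, hf n hn, hf _ (hn.trans n.le_succ)]

theorem jordanSum_apply (T : End k V) {c : ℕ} (f : truncSeq k V c) (n : ℕ) :
    (jordanSum T c f).1 n = T (f.1 n) + f.1 (n + 1) := rfl

theorem mem_ker_jordanSum {T : End k V} {c : ℕ} {f : truncSeq k V c} :
    f ∈ LinearMap.ker (jordanSum T c) ↔ ∀ n, f.1 n = ((-T) ^ n) (f.1 0) := by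
  simp only [LinearMap.mem_ker, Subtype.ext_iff, funext_iff, jordanSum_apply]
  constructor
  · intro h n
    induction n with
    | zero => rfl
    | succ n ih =>
      rw [pow_succ', End.mul_apply, ← ih, LinearMap.neg_apply]
      exact (neg_eq_of_add_eq_zero_right (h n)).symm
  · intro h n
    rw [h (n + 1), pow_succ', End.mul_apply, ← h n]
    exact add_neg_cancel _

theorem ker_neg_pow (T : End k V) (c : ℕ) :
    LinearMap.ker ((-T) ^ c) = LinearMap.ker (T ^ c) := by
  rcases c.even_or_odd with hc | hc <;> ext <;> simp [hc.neg_pow]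

theorem finrank_ker_jordanSum (T : End k V) (c : ℕ) :
    finrank k (LinearMap.ker (jordanSum T c)) = finrank k (LinearMap.ker (T ^ c)) := by
  rw [← ker_neg_pow]
  refine LinearEquiv.finrank_eq
    { toFun f := ⟨f.1.1 0, ?_⟩
      invFun v := ⟨⟨fun n => ((-T) ^ n) v, ?_⟩, mem_ker_jordanSum.2 fun n => rfl⟩
      map_add' _ _ := rfl
      map_smul' _ _ := rfl
      left_inv f := Subtype.ext (Subtype.ext (funext fun n => (mem_ker_jordanSum.1 f.2 n).symm))
      right_inv _ := rfl }
  · rw [LinearMap.mem_ker, ← mem_ker_jordanSum.1 f.2 c]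
    exact f.1.2 c le_rfl
  · intro n hn
    exact (LinearMap.iterateKer (-T)).monotone hn v.2

theorem jordanSum_two_pow_succ_apply (T : End k V) (c : ℕ) (f : truncSeq k V 2) :
    ((jordanSum T 2 ^ (c + 1)) f).1 0 = (T ^ c) (T (f.1 0) + ((c : k) + 1) • f.1 1) ∧
      ((jordanSum T 2 ^ (c + 1)) f).1 1 = (T ^ (c + 1)) (f.1 1) := by
  induction c generalizing f with
  | zero => simp [jordanSum_apply, f.2 2 le_rfl]
  | succ c ih =>
    rw [pow_succ, End.mul_apply, (ih _).1, (ih _).2]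
    simp only [jordanSum_apply, f.2 2 le_rfl, add_zero, pow_succ, End.mul_apply, map_add, map_smul,
      Nat.cast_succ, add_smul, one_smul]
    exact ⟨by abel, trivial⟩

theorem mem_ker_jordanSum_two_pow_succ {T : End k V} {c : ℕ} (hc : (c : k) + 1 ≠ 0)
    {f : truncSeq k V 2} :
    f ∈ LinearMap.ker (jordanSum T 2 ^ (c + 1)) ↔
      f.1 0 ∈ LinearMap.ker (T ^ (c + 2)) ∧
        T (f.1 0) + ((c : k) + 1) • f.1 1 ∈ LinearMap.ker (T ^ c) := by
  obtain ⟨h0, h1⟩ := jordanSum_two_pow_succ_apply T c f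
  have hker : jordanSum T 2 ^ (c + 1) • f = 0 ↔
      (T ^ c) (T (f.1 0) + ((c : k) + 1) • f.1 1) = 0 ∧ (T ^ (c + 1)) (f.1 1) = 0 := by
    rw [← h0, ← h1]
    refine ⟨fun h => by simp [← End.smul_def, h], fun ⟨h0, h1⟩ => Subtype.ext (funext fun n => ?_)⟩
    match n with
    | 0 => exact h0
    | 1 => exact h1
    | n + 2 => exact ((jordanSum T 2 ^ (c + 1)) f).2 _ (by omega)
  have hsucc : (T ^ (c + 2)) (f.1 0) + ((c : k) + 1) • (T ^ (c + 1)) (f.1 1) =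
      T ((T ^ c) (T (f.1 0) + ((c : k) + 1) • f.1 1)) := by
    rw [← End.mul_apply, ← pow_succ', map_add, map_smul, ← End.mul_apply (T ^ (c + 1)), ← pow_succ]
  rw [LinearMap.mem_ker, LinearMap.mem_ker, LinearMap.mem_ker, ← End.smul_def, hker, and_comm]
  refine and_congr_left fun h => ?_
  rw [h, map_zero] at hsucc
  rw [eq_neg_of_add_eq_zero_left hsucc, neg_eq_zero, smul_eq_zero_iff_right hc]

/-- A linear analogue of the Clebsch-Gordan rule: a Jordan block of size `2` times one of size `m`
is a sum of blocks of sizes `m + 1` and `m - 1`. -/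
theorem finrank_ker_jordanSum_two_pow_succ [FiniteDimensional k V] (T : End k V) {c : ℕ}
    (hc : (c : k) + 1 ≠ 0) :
    finrank k (LinearMap.ker (jordanSum T 2 ^ (c + 1))) =
      finrank k (LinearMap.ker (T ^ (c + 2))) + finrank k (LinearMap.ker (T ^ c)) := by
  let seq (v : V × V) : truncSeq k V 2 :=
    ⟨fun | 0 => v.1 | 1 => ((c : k) + 1)⁻¹ • (v.2 - T v.1) | _ + 2 => 0,
      by rintro (_ | _ | n) hn <;> first | rfl | omega⟩
  have hseq (v : V × V) : T v.1 + ((c : k) + 1) • ((c : k) + 1)⁻¹ • (v.2 - T v.1) = v.2 := by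
    rw [smul_inv_smul₀ hc, add_sub_cancel]
  rw [← finrank_prod]
  exact LinearEquiv.finrank_eq
    { toFun f := (⟨f.1.1 0, ((mem_ker_jordanSum_two_pow_succ hc).1 f.2).1⟩,
        ⟨T (f.1.1 0) + ((c : k) + 1) • f.1.1 1, ((mem_ker_jordanSum_two_pow_succ hc).1 f.2).2⟩)
      invFun v := ⟨seq (v.1, v.2), (mem_ker_jordanSum_two_pow_succ hc).2
        ⟨v.1.2, (hseq (v.1, v.2)).symm ▸ v.2.2⟩⟩
      map_add' f g := Prod.ext rfl (Subtype.ext (by simp [add_add_add_comm]))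
      map_smul' a f := Prod.ext rfl (Subtype.ext (by simp [smul_comm a]))
      left_inv f := by
        ext n
        match n with
        | 0 => rfl
        | 1 => simp [seq, hc]
        | n + 2 => exact (f.1.2 _ (by omega)).symm
      right_inv v := Prod.ext rfl (Subtype.ext (hseq (v.1, v.2))) }

end JordanSum

section Box

variable {ι : Type*} (k : Type*) [Field k]

/-- The functions on `ι → ℕ` supported in the box of the `j` with `j i < a i` for all `i`. This is
Macaulay's inverse system of the ideal `(X i ^ a i)`, a function standing for the linear functional
with these values on the monomials. -/
def box (a : ι → ℕ) : Submodule k ((ι → ℕ) → k) where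
  carrier := {f | ∀ j i, a i ≤ j i → f j = 0}
  zero_mem' _ _ _ := rfl
  add_mem' hf hg j i h := by simp [hf j i h, hg j i h]
  smul_mem' c f hf j i h := by simp [hf j i h]

open Classical in
/-- Functions supported in a box are the functions on that box. -/
noncomputable def boxEquiv (a : ι → ℕ) : box k a ≃ₗ[k] ((∀ i, Fin (a i)) → k) where
  toFun f x := f.1 fun i => x i
  map_add' _ _ := rfl
  map_smul' _ _ := rfl
  invFun g := ⟨fun j => if h : ∀ i, j i < a i then g fun i => ⟨j i, h i⟩ else 0,
    fun j i h => dif_neg fun h' => (h' i).not_ge h⟩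
  left_inv f := by
    ext j
    by_cases h : ∀ i, j i < a i
    · simp [h]
    · obtain ⟨i, hi⟩ : ∃ i, a i ≤ j i := by simpa using h
      rw [f.2 j i hi]
      exact dif_neg h
  right_inv g := by ext x; simp

instance [Finite ι] (a : ι → ℕ) : FiniteDimensional k (box k a) :=
  Module.Finite.equiv (boxEquiv k a).symm

variable [Fintype ι]

theorem finrank_box (a : ι → ℕ) : finrank k (box k a) = ∏ i, a i := by
  classical
  rw [(boxEquiv k a).finrank_eq, finrank_fintype_fun_eq_card, Fintype.card_pi]
  simp only [Fintype.card_fin]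

variable [DecidableEq ι]

/-- The operator dual to multiplication by `∑ i, X i ^ d i`. -/
def diagShift (d : ι → ℕ) : End k ((ι → ℕ) → k) :=
  ∑ i, LinearMap.funLeft k k (· + Pi.single i (d i))

theorem diagShift_apply (d : ι → ℕ) (f : (ι → ℕ) → k) (j : ι → ℕ) :
    diagShift k d f j = ∑ i, f (j + Pi.single i (d i)) := by
  simp [diagShift, LinearMap.funLeft_apply]

variable {k} in
theorem diagShift_mem_box (d : ι → ℕ) {a : ι → ℕ} {f : (ι → ℕ) → k} (hf : f ∈ box k a) :
    diagShift k d f ∈ box k a := fun j i h => by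
  rw [diagShift_apply]
  exact Finset.sum_eq_zero fun i' _ => hf _ i (h.trans (Nat.le_add_right _ _))

/-- The operator `diagShift k d` on the functions supported in the box `a`. -/
def boxShift (d a : ι → ℕ) : End k (box k a) :=
  (diagShift k d).restrict fun _ hf => diagShift_mem_box d hf

theorem coe_boxShift (d a : ι → ℕ) (f : box k a) : (boxShift k d a f : (ι → ℕ) → k) =
    diagShift k d f := rfl

theorem coe_boxShift_pow (d a : ι → ℕ) (c : ℕ) (f : box k a) :
    ((boxShift k d a ^ c) f : (ι → ℕ) → k) = (diagShift k d ^ c) f := by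
  rw [boxShift, End.pow_restrict]
  rfl

/-- The dimension of the kernel of the `c`-th power of `boxShift k d a`, which is the colength of
the ideal generated by `(∑ i, X i ^ d i) ^ c` and the `X i ^ a i`. -/
noncomputable def boxNullity (d a : ι → ℕ) (c : ℕ) : ℕ :=
  finrank k (LinearMap.ker (boxShift k d a ^ c))

/-- The colength of the ideal generated by `∑ i, X i` and the `X i ^ a i`. -/
noncomputable def linColength (a : ι → ℕ) : ℕ := boxNullity k 1 a 1

theorem boxNullity_zero (d a : ι → ℕ) : boxNullity k d a 0 = 0 := by
  rw [boxNullity, pow_zero, End.one_eq_id, LinearMap.ker_id, finrank_bot]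

theorem boxNullity_add_le (a : ι → ℕ) (c e : ℕ) :
    boxNullity k 1 a (c + e) ≤ boxNullity k 1 a c + e * linColength k a := by
  rw [linColength, boxNullity, boxNullity, boxNullity, pow_one]
  exact finrank_ker_pow_add_le _ c e

theorem linColength_mono {a b : ι → ℕ} (hab : a ≤ b) : linColength k a ≤ linColength k b := by
  have hbox : box k a ≤ box k b := fun f hf j i h => hf j i ((hab i).trans h)
  rw [linColength, linColength, boxNullity, boxNullity, pow_one, pow_one]
  exact LinearMap.finrank_le_finrank_of_injective
    (f := (Submodule.inclusion hbox).restrict fun f hf => Subtype.ext (congrArg Subtype.val hf :))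
    fun f g h => Subtype.ext (Subtype.ext (congrArg (fun f => f.1.1) h :))

theorem linColength_pos {a : ι → ℕ} (ha : ∀ i, 0 < a i) : 0 < linColength k a := by
  let δ : box k a := ⟨Pi.single 0 1, fun j i h =>
    Pi.single_eq_of_ne (fun hj => by simp [hj, (ha i).ne'] at h) _⟩
  have hδ : boxShift k 1 a δ = 0 := Subtype.ext (funext fun j => by
    rw [coe_boxShift, diagShift_apply]
    exact Finset.sum_eq_zero fun i _ => Pi.single_eq_of_ne
      (fun hj => by simpa using congrFun hj i) _)
  rw [linColength, boxNullity, pow_one]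
  refine (finrank_pos_iff_exists_ne_zero (R := k)).2
    ⟨(⟨δ, hδ⟩ : LinearMap.ker (boxShift k 1 a)), fun h => one_ne_zero (α := k) ?_⟩
  simpa [δ] using congrFun (congrArg (fun f => f.1.1) h) 0

end Box

section Coordinate

variable (k : Type*) [Field k] {s : ℕ}

theorem insertNth_add_single_self (i : Fin (s + 1)) (n : ℕ) (j : Fin s → ℕ) :
    (i.insertNth n j + Pi.single i 1 : Fin (s + 1) → ℕ) = i.insertNth (n + 1) j := by
  rw [← Fin.insertNth_zero_right, ← Fin.insertNth_add, add_zero]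

theorem insertNth_add_single_succAbove (i : Fin (s + 1)) (n : ℕ) (j : Fin s → ℕ) (x : Fin s) :
    (i.insertNth n j + Pi.single (i.succAbove x) 1 : Fin (s + 1) → ℕ) =
      i.insertNth n (j + Pi.single x 1) := by
  rw [Pi.single, Pi.single, ← add_zero n, Fin.insertNth_add, Fin.insertNth_update,
    Fin.insertNth_zero_right, Pi.single_zero, add_zero]

/-- Slicing along the coordinate `i`. -/
def boxSliceEquiv (i : Fin (s + 1)) (a : Fin (s + 1) → ℕ) :
    box k a ≃ₗ[k] truncSeq k (box k (i.removeNth a)) (a i) where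
  toFun f := ⟨fun n => ⟨fun j => f.1 (i.insertNth n j),
      fun j x h => f.2 _ (i.succAbove x) (by simpa [Fin.removeNth_apply] using h)⟩,
    fun n hn => Subtype.ext (funext fun j => f.2 _ i (by simpa using hn))⟩
  map_add' _ _ := rfl
  map_smul' _ _ := rfl
  invFun g := ⟨fun j => (g.1 (j i)).1 (i.removeNth j), fun j x h => by
    rcases Fin.eq_self_or_eq_succAbove i x with rfl | ⟨x, rfl⟩
    · exact congrFun (congrArg Subtype.val (g.2 _ h)) _
    · exact (g.1 (j i)).2 _ x h⟩
  left_inv f := by ext j; simp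
  right_inv g := by ext n j; simp

theorem boxSliceEquiv_boxShift (i : Fin (s + 1)) (a : Fin (s + 1) → ℕ) (f : box k a) :
    boxSliceEquiv k i a (boxShift k 1 a f) =
      jordanSum (boxShift k 1 (i.removeNth a)) (a i) (boxSliceEquiv k i a f) := by
  refine Subtype.ext (funext fun n => Subtype.ext (funext fun j => ?_))
  rw [jordanSum_apply]
  change diagShift k 1 f.1 (i.insertNth n j) =
    diagShift k 1 (fun j => f.1 (i.insertNth n j)) j + f.1 (i.insertNth (n + 1) j)
  rw [diagShift_apply, diagShift_apply, Fin.sum_univ_succAbove _ i, add_comm]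
  simp only [Pi.one_apply, insertNth_add_single_self, insertNth_add_single_succAbove]

theorem boxNullity_eq_finrank_ker_jordanSum (i : Fin (s + 1)) (a : Fin (s + 1) → ℕ) (c : ℕ) :
    boxNullity k 1 a c = finrank k (LinearMap.ker
      (jordanSum (boxShift k 1 (i.removeNth a)) (a i) ^ c)) :=
  finrank_ker_pow_eq_of_intertwine (V := box k a) (W := truncSeq k (box k (i.removeNth a)) (a i))
    (boxSliceEquiv k i a) (boxSliceEquiv_boxShift k i a) c

theorem linColength_eq_boxNullity_removeNth (i : Fin (s + 1)) (a : Fin (s + 1) → ℕ) :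
    linColength k a = boxNullity k 1 (i.removeNth a) (a i) := by
  rw [linColength, boxNullity_eq_finrank_ker_jordanSum k i, pow_one, finrank_ker_jordanSum]
  rfl

theorem boxNullity_removeNth_of_eq_two {i : Fin (s + 1)} {a : Fin (s + 1) → ℕ} (ha : a i = 2)
    {c : ℕ} (hc : (c : k) + 1 ≠ 0) :
    boxNullity k 1 a (c + 1) =
      boxNullity k 1 (i.removeNth a) (c + 2) + boxNullity k 1 (i.removeNth a) c := by
  rw [boxNullity_eq_finrank_ker_jordanSum k i, ha, finrank_ker_jordanSum_two_pow_succ _ hc]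
  rfl

theorem linColength_update_le (a : Fin (s + 2) → ℕ) {N : ℕ} (ha : ∀ i, a i ≤ N) {i : Fin (s + 2)}
    {c : ℕ} (hc : a i ≤ c) :
    linColength k (Function.update a i c) ≤ linColength k a + (c - a i) * N ^ s := by
  have hN : linColength k (i.removeNth a) ≤ N ^ s := by
    rw [linColength_eq_boxNullity_removeNth k 0]
    calc boxNullity k 1 _ _ ≤ finrank k (box k (Fin.removeNth 0 (i.removeNth a))) :=
          Submodule.finrank_le _
      _ ≤ N ^ s := by
        rw [finrank_box]
        exact (Finset.prod_le_pow_card _ _ N fun _ _ => ha _).trans (by simp)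
  rw [linColength_eq_boxNullity_removeNth k i, linColength_eq_boxNullity_removeNth k i a,
    Fin.removeNth_update, Function.update_self]
  calc boxNullity k 1 (i.removeNth a) c
      = boxNullity k 1 (i.removeNth a) (a i + (c - a i)) := by rw [Nat.add_sub_cancel' hc]
    _ ≤ boxNullity k 1 (i.removeNth a) (a i) + (c - a i) * linColength k (i.removeNth a) :=
      boxNullity_add_le k _ _ _
    _ ≤ _ := by gcongr

theorem linColength_le_add_sum_mul {a b : Fin (s + 2) → ℕ} (hab : a ≤ b) {N : ℕ}
    (hb : ∀ i, b i ≤ N) :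
    linColength k b ≤ linColength k a + (∑ i, (b i - a i)) * N ^ s := by
  have key (t : Finset (Fin (s + 2))) :
      linColength k (t.piecewise b a) ≤ linColength k a + (∑ i ∈ t, (b i - a i)) * N ^ s := by
    induction t using Finset.induction_on with
    | empty => simp
    | insert i t hi ih =>
      have hai : t.piecewise b a i = a i := Finset.piecewise_eq_of_notMem _ _ _ hi
      have hle (x) : t.piecewise b a x ≤ N :=
        (Finset.piecewise_le_of_le_of_le t le_rfl hab x).trans (hb x)
      rw [Finset.piecewise_insert, Finset.sum_insert hi]
      calc _ ≤ linColength k (t.piecewise b a) + (b i - a i) * N ^ s := by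
            simpa only [hai] using linColength_update_le k _ hle (hai.trans_le (hab i))
        _ ≤ _ := by linarith
  simpa only [Finset.piecewise_univ] using key Finset.univ

end Coordinate

section Residues

variable {ι : Type*} (k : Type*) [Field k]

/-- The side lengths of the box of those `j` for which `r + m * j` lies in the box `b`. -/
def residueBox (m b : ι → ℕ) (r : ∀ i, Fin (m i)) (i : ι) : ℕ :=
  (b i + m i - 1 - r i) / m i

theorem residueBox_le_iff {m b : ι → ℕ} (r : ∀ i, Fin (m i)) (i : ι) (n : ℕ) :
    residueBox m b r i ≤ n ↔ b i ≤ r i + m i * n := by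
  have hr := (r i).2
  rw [residueBox, ← Nat.lt_succ_iff, Nat.div_lt_iff_lt_mul (by omega), Nat.succ_mul, mul_comm n]
  omega

theorem residueBox_mul (m a : ι → ℕ) (r : ∀ i, Fin (m i)) : residueBox m (m * a) r = a := by
  funext i
  have hr := (r i).2
  refine eq_of_forall_ge_iff fun n => ?_
  rw [residueBox_le_iff, Pi.mul_apply]
  refine ⟨fun h => Nat.lt_succ_iff.1 (lt_of_mul_lt_mul_left' (a := m i) ?_), fun h => ?_⟩
  · rw [Nat.mul_succ]
    omega
  · exact (Nat.mul_le_mul_left _ h).trans (Nat.le_add_left _ _)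

/-- Division with remainder by `m`. -/
def residueEquiv {m : ι → ℕ} (hm : ∀ i, 0 < m i) : (ι → ℕ) ≃ (∀ i, Fin (m i)) × (ι → ℕ) where
  toFun j := (fun i => ⟨j i % m i, Nat.mod_lt _ (hm i)⟩, fun i => j i / m i)
  invFun rj i := rj.1 i + m i * rj.2 i
  left_inv j := funext fun i => Nat.mod_add_div _ _
  right_inv rj := by
    ext i
    · simp [Nat.mod_eq_of_lt (rj.1 i).2]
    · simp [Nat.add_mul_div_left _ _ (hm i), Nat.div_eq_of_lt (rj.1 i).2]

/-- Splitting functions according to the residue class of the argument modulo `m`. -/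
def boxResidueEquiv {m : ι → ℕ} (hm : ∀ i, 0 < m i) (b : ι → ℕ) :
    box k b ≃ₗ[k] ∀ r, box k (residueBox m b r) where
  toFun f r := ⟨fun j => f.1 ((residueEquiv hm).symm (r, j)),
    fun j i h => f.2 _ i ((residueBox_le_iff r i _).1 h)⟩
  map_add' _ _ := rfl
  map_smul' _ _ := rfl
  invFun g := ⟨fun j => (g (residueEquiv hm j).1).1 (residueEquiv hm j).2, fun j i h =>
    (g _).2 _ i ((residueBox_le_iff _ i _).2
      (h.trans_eq (congrFun ((residueEquiv hm).symm_apply_apply j).symm i)))⟩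
  left_inv f := by ext j; simp
  right_inv g := by
    ext r j
    change (g (residueEquiv hm ((residueEquiv hm).symm (r, j))).1).1
      (residueEquiv hm ((residueEquiv hm).symm (r, j))).2 = (g r).1 j
    rw [Equiv.apply_symm_apply]

variable [Fintype ι] [DecidableEq ι]

theorem boxResidueEquiv_boxShift {m : ι → ℕ} (hm : ∀ i, 0 < m i) (d b : ι → ℕ) (f : box k b) :
    boxResidueEquiv k hm b (boxShift k (m * d) b f) =
      LinearMap.piMap (fun r => boxShift k d (residueBox m b r)) (boxResidueEquiv k hm b f) := by
  refine funext fun r => Subtype.ext (funext fun j => ?_)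
  change diagShift k (m * d) f.1 (fun i => r i + m i * j i) =
    diagShift k d (fun j => f.1 fun i => r i + m i * j i) j
  rw [diagShift_apply, diagShift_apply]
  refine Finset.sum_congr rfl fun i _ => congrArg f.1 (funext fun x => ?_)
  by_cases hx : x = i
  · subst hx
    simp [mul_add, add_assoc]
  · simp [hx]

/-- Substituting `X i ^ m i` for `X i` gives a free extension, with the monomials of exponent less
than `m` as a basis; this is what it means for the colengths. -/
theorem boxNullity_mul {m : ι → ℕ} (hm : ∀ i, 0 < m i) (d b : ι → ℕ) (c : ℕ) :
    boxNullity k (m * d) b c =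
      ∑ r : ∀ i, Fin (m i), boxNullity k d (residueBox m b r) c :=
  (finrank_ker_pow_eq_of_intertwine (boxResidueEquiv k hm b) (boxResidueEquiv_boxShift k hm d b)
    c).trans (finrank_ker_piMap_pow _ c)

end Residues

section Frobenius

variable {ι : Type*} [Fintype ι] [DecidableEq ι] (k : Type*) [Field k] (p : ℕ) [Fact p.Prime]
  [CharP k p]

theorem funLeft_add_pow {M : Type*} [AddCommMonoid M] (v : M) (n : ℕ) :
    LinearMap.funLeft k k (· + v) ^ n = LinearMap.funLeft k k (· + n • v) := by
  induction n with
  | zero => ext; simp [LinearMap.funLeft_apply]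
  | succ n ih =>
    ext f j
    rw [pow_succ, ih, End.mul_apply]
    simp only [LinearMap.funLeft_apply, add_assoc, succ_nsmul]

theorem diagShift_pow_char (d : ι → ℕ) : diagShift k d ^ p = diagShift k (p • d) := by
  have : CharP (End k ((ι → ℕ) → k)) p :=
    charP_of_injective_algebraMap (FaithfulSMul.algebraMap_injective k _) p
  have key (t : Finset ι) : (∑ i ∈ t, LinearMap.funLeft k k (· + Pi.single i (d i))) ^ p =
      ∑ i ∈ t, LinearMap.funLeft k k (· + (Pi.single i ((p • d) i) : ι → ℕ)) := by
    induction t using Finset.induction_on with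
    | empty => simp [(Fact.out : p.Prime).ne_zero]
    | insert i t hi ih =>
      rw [Finset.sum_insert hi, Finset.sum_insert hi, add_pow_char_of_commute, ih, funLeft_add_pow,
        ← Pi.single_smul, Pi.smul_apply]
      refine Commute.sum_right _ _ _ fun j _ => LinearMap.ext fun f => funext fun x => ?_
      simp only [End.mul_apply, LinearMap.funLeft_apply, add_right_comm]
  exact key Finset.univ

theorem boxShift_pow_char (d a : ι → ℕ) : boxShift k d a ^ p = boxShift k (p • d) a :=
  LinearMap.ext fun f => Subtype.ext <| by
    rw [coe_boxShift_pow, coe_boxShift, diagShift_pow_char]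

theorem boxNullity_char_mul (d a : ι → ℕ) (c : ℕ) :
    boxNullity k d a (p * c) = boxNullity k (p • d) a c := by
  rw [boxNullity, boxNullity, pow_mul, boxShift_pow_char]

theorem boxNullity_char {a : ι → ℕ} (ha : ∀ i, a i ≤ p) : boxNullity k 1 a p = ∏ i, a i := by
  have hzero : boxShift k 1 a ^ p = 0 := by
    refine LinearMap.ext fun f => Subtype.ext (funext fun j => ?_)
    rw [boxShift_pow_char, coe_boxShift, diagShift_apply]
    exact Finset.sum_eq_zero fun i _ => f.2 _ i ((ha i).trans (by simp))
  rw [boxNullity, hzero, LinearMap.ker_zero, finrank_top, finrank_box]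

theorem boxNullity_char_smul (a : ι → ℕ) (c : ℕ) :
    boxNullity k 1 (p • a) (p * c) = p ^ Fintype.card ι * boxNullity k 1 a c := by
  have hp : ∀ _ : ι, 0 < p := fun _ => (Fact.out : p.Prime).pos
  have hsmul (b : ι → ℕ) : p • b = (fun _ => p) * b := rfl
  rw [boxNullity_char_mul, hsmul, hsmul, boxNullity_mul k hp]
  simp [residueBox_mul]

variable {s : ℕ}

theorem linColength_char_smul (a : Fin (s + 1) → ℕ) :
    linColength k (p • a) = p ^ s * linColength k a := by
  rw [linColength_eq_boxNullity_removeNth k 0, linColength_eq_boxNullity_removeNth k 0 a]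
  exact (boxNullity_char_smul k p (Fin.removeNth 0 a) (a 0)).trans (by rw [Fintype.card_fin])

theorem linColength_of_eq_char {i : Fin (s + 1)} {a : Fin (s + 1) → ℕ} (hi : a i = p)
    (ha : ∀ j, a j ≤ p) : linColength k a = ∏ j, i.removeNth a j := by
  rw [linColength_eq_boxNullity_removeNth k i, hi, boxNullity_char]
  exact fun j => ha _

end Frobenius

section Length

variable {k σ M : Type*} [Field k] [AddCommGroup M] [Module (MvPolynomial σ k) M]
  [modk : Module k M] [tower : IsScalarTower k (MvPolynomial σ k) M]

open MvPolynomial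

theorem smul_eq_constantCoeff_smul (hX : ∀ (i : σ) (m : M), (X i : MvPolynomial σ k) • m = 0)
    (f : MvPolynomial σ k) (m : M) : f • m = constantCoeff f • m := by
  induction f using MvPolynomial.induction_on with
  | C a => rw [constantCoeff_C, ← algebraMap_eq, algebraMap_smul]
  | add f g hf hg => rw [add_smul, hf, hg, map_add, add_smul]
  | mul_X f i => rw [mul_smul, hX, smul_zero, map_mul, constantCoeff_X, mul_zero, zero_smul]

theorem isSimpleModule_of_X_nilpotent [IsSimpleModule (MvPolynomial σ k) M]
    (hX : ∀ i, ∃ n : ℕ, (X i : MvPolynomial σ k) ^ n ∈ annihilator (MvPolynomial σ k) M) :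
    IsSimpleModule k M := by
  have hX0 (i : σ) (m : M) : (X i : MvPolynomial σ k) • m = 0 :=
    mem_annihilator.1 ((IsSimpleModule.annihilator_isMaximal.isPrime.isRadical) (hX i)) m
  rw [isSimpleModule_iff_toSpanSingleton_surjective]
  refine ⟨IsSimpleModule.nontrivial (MvPolynomial σ k) M, fun m hm x => ?_⟩
  obtain ⟨f, hf⟩ := IsSimpleModule.toSpanSingleton_surjective (MvPolynomial σ k) hm x
  exact ⟨constantCoeff f, (smul_eq_constantCoeff_smul hX0 f m).symm.trans hf⟩

theorem length_eq_length_of_X_nilpotent (hM : IsFiniteLength (MvPolynomial σ k) M)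
    (hX : ∀ i, ∃ n : ℕ, (X i : MvPolynomial σ k) ^ n ∈ annihilator (MvPolynomial σ k) M) :
    Module.length (MvPolynomial σ k) M = Module.length k M := by
  induction hM generalizing modk tower with
  | of_subsingleton => rw [Module.length_eq_zero, Module.length_eq_zero]
  | @of_simple_quotient M _ _ N _ _ ih =>
    have hN := ih fun i => (hX i).imp fun _ h =>
      LinearMap.annihilator_le_of_injective N.subtype N.subtype_injective h
    have : IsSimpleModule k (M ⧸ N) := isSimpleModule_of_X_nilpotent fun i => (hX i).imp fun _ h =>
      LinearMap.annihilator_le_of_surjective N.mkQ N.mkQ_surjective h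
    rw [Module.length_eq_add_of_exact N.subtype N.mkQ N.subtype_injective N.mkQ_surjective
        (LinearMap.exact_subtype_mkQ N), hN, Module.length_eq_one (MvPolynomial σ k) (M ⧸ N),
      Module.length_eq_add_of_exact (N.subtype.restrictScalars k) (N.mkQ.restrictScalars k)
        N.subtype_injective N.mkQ_surjective (LinearMap.exact_subtype_mkQ N),
      Module.length_eq_one k (M ⧸ N)]

theorem length_eq_finrank_of_X_nilpotent [FiniteDimensional k M]
    (hX : ∀ i, ∃ n : ℕ, (X i : MvPolynomial σ k) ^ n ∈ annihilator (MvPolynomial σ k) M) :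
    Module.length (MvPolynomial σ k) M = finrank k M := by
  have : IsArtinian (MvPolynomial σ k) M := isArtinian_of_tower k inferInstance
  have : IsNoetherian (MvPolynomial σ k) M := isNoetherian_of_tower k inferInstance
  rw [length_eq_length_of_X_nilpotent (isFiniteLength_iff_isNoetherian_isArtinian.2 ⟨‹_›, ‹_›⟩) hX,
    Module.length_eq_finrank]

end Length

section Duality

open MvPolynomial

variable {ι : Type*} (k : Type*) [Field k]

variable {k} in
theorem forall_mem_span_iff (φ : Dual k (MvPolynomial ι k)) (S : Set (MvPolynomial ι k)) :
    (∀ x ∈ Ideal.span S, φ x = 0) ↔ ∀ x ∈ S, ∀ g, φ (g * x) = 0 := by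
  refine ⟨fun h x hx g => h _ (Ideal.mul_mem_left _ _ (Ideal.subset_span hx)), fun h x hx => ?_⟩
  induction hx using Submodule.closure_induction with
  | zero => exact map_zero φ
  | add x y _ _ hx hy => rw [map_add, hx, hy, add_zero]
  | smul_mem g x hx => exact h x hx g

theorem mem_box_iff_funLeft [DecidableEq ι] (b : ι → ℕ) (f : (ι → ℕ) → k) :
    f ∈ box k b ↔
      ∀ i, LinearMap.funLeft k k (fun j : ι → ℕ => j + Pi.single i (b i)) f = 0 := by
  refine ⟨fun hf i => funext fun j => hf _ i (by simp), fun hf j i h => ?_⟩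
  have hj : j - Pi.single i (b i) + Pi.single i (b i) = j :=
    tsub_add_cancel_of_le (update_le_iff.2 ⟨h, fun _ _ => Nat.zero_le _⟩)
  rw [← hj]
  exact congrFun (hf i) _

variable [Fintype ι]

/-- The linear functionals on polynomials, given by their values on the monomials. -/
noncomputable def dualEquiv : ((ι → ℕ) → k) ≃ₗ[k] Dual k (MvPolynomial ι k) :=
  LinearEquiv.funCongrLeft k k Finsupp.equivFunOnFinite ≪≫ₗ (basisMonomials ι k).constr k

theorem dualEquiv_monomial (f : (ι → ℕ) → k) (m : ι →₀ ℕ) :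
    dualEquiv k f (monomial m 1) = f m :=
  (basisMonomials ι k).constr_basis k _ m

variable [DecidableEq ι]

theorem dualEquiv_mul_X_pow (f : (ι → ℕ) → k) (g : MvPolynomial ι k) (i : ι) (n : ℕ) :
    dualEquiv k f (g * X i ^ n) = dualEquiv k (LinearMap.funLeft k k (· + Pi.single i n) f) g := by
  suffices h : dualEquiv k f ∘ₗ LinearMap.mulRight k (X i ^ n) =
      dualEquiv k (LinearMap.funLeft k k (· + Pi.single i n) f) from LinearMap.congr_fun h g
  refine (basisMonomials ι k).ext fun m => ?_
  rw [coe_basisMonomials, LinearMap.comp_apply, LinearMap.mulRight_apply, X_pow_eq_monomial,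
    monomial_mul, one_mul, dualEquiv_monomial, dualEquiv_monomial, LinearMap.funLeft_apply,
    Finsupp.coe_add, Finsupp.single_eq_pi_single]

theorem dualEquiv_mul_sum_X_pow (d : ι → ℕ) (f : (ι → ℕ) → k) (g : MvPolynomial ι k) :
    dualEquiv k f (g * ∑ i, X i ^ d i) = dualEquiv k (diagShift k d f) g := by
  simp only [Finset.mul_sum, map_sum, dualEquiv_mul_X_pow, diagShift, LinearMap.sum_apply]

/-- The ideal generated by `∑ i, X i ^ d i` and the `X i ^ b i`. -/
noncomputable def diagonalIdeal (d b : ι → ℕ) : Ideal (MvPolynomial ι k) :=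
  Ideal.span (insert (∑ i, X i ^ d i) (Set.range fun i => X i ^ b i))

theorem map_dualEquiv_eq_dualAnnihilator (d b : ι → ℕ) :
    (box k b ⊓ LinearMap.ker (diagShift k d)).map (dualEquiv k).toLinearMap =
      ((diagonalIdeal k d b).restrictScalars k).dualAnnihilator := by
  ext φ
  obtain ⟨f, rfl⟩ := (dualEquiv k).surjective φ
  rw [Submodule.mem_map_equiv, LinearEquiv.symm_apply_apply, Submodule.mem_dualAnnihilator]
  refine Iff.trans ?_ (forall_mem_span_iff _ _).symm
  have hzero (f : (ι → ℕ) → k) : (∀ g, dualEquiv k f g = 0) ↔ f = 0 :=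
    LinearMap.ext_iff.symm.trans (dualEquiv k).map_eq_zero_iff
  rw [Submodule.mem_inf, mem_box_iff_funLeft, LinearMap.mem_ker, Set.forall_mem_insert,
    Set.forall_mem_range]
  simp only [dualEquiv_mul_X_pow, dualEquiv_mul_sum_X_pow, hzero, and_comm]

/-- Macaulay duality for the ideal generated by `∑ i, X i ^ d i` and the `X i ^ b i`. -/
noncomputable def dualQuotientEquiv (d b : ι → ℕ) :
    Dual k (MvPolynomial ι k ⧸ diagonalIdeal k d b) ≃ₗ[k] LinearMap.ker (boxShift k d b) :=
  (Submodule.Quotient.restrictScalarsEquiv k (diagonalIdeal k d b)).dualMap ≪≫ₗ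
    Submodule.dualQuotEquivDualAnnihilator _ ≪≫ₗ
    LinearEquiv.ofEq _ _ (map_dualEquiv_eq_dualAnnihilator k d b).symm ≪≫ₗ
    ((dualEquiv k).submoduleMap _).symm ≪≫ₗ
    LinearEquiv.ofEq _ _ (by rw [boxShift, LinearMap.ker_restrict, Submodule.map_comap_subtype]) ≪≫ₗ
    (Submodule.equivSubtypeMap (box k b) (LinearMap.ker (boxShift k d b))).symm

theorem length_quotient_diagonalIdeal (d b : ι → ℕ) :
    Module.length (MvPolynomial ι k) (MvPolynomial ι k ⧸ diagonalIdeal k d b) =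
      boxNullity k d b 1 := by
  have : FiniteDimensional k (MvPolynomial ι k ⧸ diagonalIdeal k d b) :=
    (Module.finite_dual_iff k).1 (Module.Finite.equiv (dualQuotientEquiv k d b).symm)
  rw [length_eq_finrank_of_X_nilpotent, boxNullity, pow_one, ← Subspace.dual_finrank_eq,
    (dualQuotientEquiv k d b).finrank_eq]
  refine fun i => ⟨b i, ?_⟩
  rw [Ideal.annihilator_quotient]
  exact Ideal.subset_span (Or.inr ⟨i, rfl⟩)

theorem hkColength_diagonalForm (p : ℕ) [Fact p.Prime] {s : ℕ} {d : Fin s → ℕ}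
    (hd : ∀ i, 0 < d i) (n : ℕ) : hkColength (diagonalForm p d) n =
      ((∑ r, linColength (ZMod p) (residueBox d (fun _ => p ^ n) r) : ℕ) : ℕ∞) := by
  refine (length_quotient_diagonalIdeal (ZMod p) d fun _ => p ^ n).trans (congrArg _ ?_)
  simpa only [mul_one, linColength] using boxNullity_mul (ZMod p) hd 1 (fun _ => p ^ n) 1

end Duality

section ResidueCount

open Polynomial Function

/-- The sum of the coefficients of a polynomial in the degrees congruent to `c` modulo `p`. -/
noncomputable def residueSum (p : ℕ) (c : ZMod p) : ℤ[X] →ₗ[ℤ] ℤ :=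
  Polynomial.lsum fun m => if (m : ZMod p) = c then LinearMap.id else 0

theorem residueSum_monomial (p : ℕ) (c : ZMod p) (m : ℕ) (x : ℤ) :
    residueSum p c (monomial m x) = if (m : ZMod p) = c then x else 0 := by
  rw [residueSum, lsum_apply, sum_monomial_index]
  · split_ifs <;> rfl
  · exact LinearMap.map_zero _

theorem residueSum_X_mul (p : ℕ) (c : ZMod p) (f : ℤ[X]) :
    residueSum p (c + 1) (X * f) = residueSum p c f := by
  induction f using Polynomial.induction_on' with
  | add f g hf hg => rw [mul_add, map_add, map_add, hf, hg]
  | monomial m x =>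
    rw [X_mul_monomial, residueSum_monomial, residueSum_monomial, Nat.cast_succ]
    exact if_congr (add_left_inj 1) rfl rfl

/-- The polynomial `1 + X + ⋯ + X ^ (n - 1)`. -/
noncomputable def geomPoly (n : ℕ) : ℤ[X] := ∑ j ∈ Finset.range n, X ^ j

theorem geomPoly_mul_one_sub (n : ℕ) : geomPoly n * (1 - X) = 1 - X ^ n :=
  geom_sum_mul_neg X n

theorem geomPoly_add_two (n : ℕ) :
    geomPoly (n + 2) + X * geomPoly n = (1 + X) * geomPoly (n + 1) := by
  simp only [geomPoly, Finset.sum_range_succ]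
  ring

theorem residueSum_geomPoly {p n : ℕ} (hn : n ≤ p) {c : ℕ} (hc : c < n) :
    residueSum p c (geomPoly n) = 1 := by
  have h (j : ℕ) (hj : j ∈ Finset.range n) :
      residueSum p c (X ^ j) = if j = c then 1 else 0 := by
    rw [X_pow_eq_monomial, residueSum_monomial]
    refine if_congr ?_ rfl rfl
    rw [ZMod.natCast_eq_natCast_iff', Nat.mod_eq_of_lt ((Finset.mem_range.1 hj).trans_le hn),
      Nat.mod_eq_of_lt (hc.trans_le hn)]
  rw [geomPoly, map_sum, Finset.sum_congr rfl h, Finset.sum_ite_eq',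
    if_pos (Finset.mem_range.2 hc)]

theorem residueSum_geomPoly_mul (p : ℕ) [NeZero p] (c : ZMod p) (f : ℤ[X]) :
    residueSum p c (geomPoly p * f) = f.eval 1 := by
  induction f using Polynomial.induction_on' with
  | add f g hf hg => rw [mul_add, map_add, hf, hg, eval_add]
  | monomial m x =>
    have h (j : ℕ) (hj : j ∈ Finset.range p) : residueSum p c (X ^ j * monomial m x) =
        if j = (c - m).val then x else 0 := by
      rw [X_pow_mul_monomial, residueSum_monomial]
      refine if_congr ?_ rfl rfl
      rw [Nat.cast_add, ← eq_sub_iff_add_eq',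
        ← (ZMod.val_injective p).eq_iff, ZMod.val_natCast_of_lt (Finset.mem_range.1 hj)]
    rw [geomPoly, Finset.sum_mul, map_sum, Finset.sum_congr rfl h, Finset.sum_ite_eq',
      if_pos (Finset.mem_range.2 (ZMod.val_lt _)), eval_monomial, one_pow, mul_one]

/-- The number of points `j` of the box `a`, `j i < a i`, with `∑ j i` congruent modulo `p` to the
middle value `⌊∑ (a i - 1) / 2⌋`, as a sum of coefficients of `∏ (1 + X + ⋯ + X ^ (a i - 1))`. -/
noncomputable def middleCount (p : ℕ) {s : ℕ} (a : Fin s → ℕ) : ℤ :=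
  residueSum p ((((∑ i, (a i : ℤ)) - s) / 2 : ℤ) : ZMod p) (∏ i, geomPoly (a i))

variable {s : ℕ}

theorem middleCount_of_eq_zero (p : ℕ) {i : Fin s} {a : Fin s → ℕ} (hi : a i = 0) :
    middleCount p a = 0 := by
  have h : geomPoly (a i) = 0 := by rw [hi]; exact Finset.sum_range_zero _
  rw [middleCount, Finset.prod_eq_zero (Finset.mem_univ i) h, map_zero]

theorem middleCount_of_eq_one (p : ℕ) {i : Fin (s + 1)} {a : Fin (s + 1) → ℕ} (hi : a i = 1) :
    middleCount p a = middleCount p (i.removeNth a) := by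
  have h : geomPoly 1 = 1 := Finset.sum_range_one _
  rw [middleCount, middleCount, Fin.prod_univ_succAbove _ i, Fin.sum_univ_succAbove _ i, hi, h,
    one_mul, Nat.cast_one, Nat.cast_succ, add_comm (s : ℤ), add_sub_add_left_eq_sub]
  rfl

theorem middleCount_of_eq_self (p : ℕ) [NeZero p] {i : Fin (s + 1)} {a : Fin (s + 1) → ℕ}
    (hi : a i = p) : middleCount p a = ∏ j, (i.removeNth a j : ℤ) := by
  rw [middleCount, Fin.prod_univ_succAbove _ i, hi, residueSum_geomPoly_mul, eval_prod]
  simp only [geomPoly, eval_finsetSum, eval_pow, eval_X, one_pow, Finset.sum_const,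
    Finset.card_range, nsmul_one]
  rfl

theorem middleCount_update_add_two (p : ℕ) {i : Fin (s + 1)} {a : Fin (s + 1) → ℕ} {n : ℕ}
    (hi : a i = n + 1) :
    middleCount p (update a i (n + 2)) + middleCount p (update a i n) =
      residueSum p ((((∑ j, (a j : ℤ)) - s) / 2 : ℤ) : ZMod p)
        ((1 + X) * ∏ j, geomPoly (a j)) := by
  simp only [middleCount, Fin.prod_univ_succAbove _ i, Fin.sum_univ_succAbove _ i, update_self,
    update_of_ne (Fin.succAbove_ne i _), hi]
  set S := ∑ j, (a (i.succAbove j) : ℤ)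
  set P := ∏ j, geomPoly (a (i.succAbove j))
  push_cast
  have hmid : ((n : ℤ) + 1 + S - s) / 2 = ((n : ℤ) + S - (s + 1)) / 2 + 1 := by omega
  have hmid' : ((n : ℤ) + 2 + S - (s + 1)) / 2 = ((n : ℤ) + S - (s + 1)) / 2 + 1 := by omega
  rw [hmid, hmid', Int.cast_add, Int.cast_one, ← residueSum_X_mul p _ (geomPoly n * P), ← map_add,
    ← mul_assoc, ← mul_assoc, ← add_mul, geomPoly_add_two]

end ResidueCount

section ExactFormula

open Function

variable (k : Type*) [Field k] {s : ℕ}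

theorem linColength_of_eq_zero {i : Fin (s + 1)} {a : Fin (s + 1) → ℕ} (hi : a i = 0) :
    linColength k a = 0 := by
  rw [linColength_eq_boxNullity_removeNth k i, hi, boxNullity_zero]

theorem linColength_of_eq_one {i : Fin (s + 1)} {a : Fin (s + 1) → ℕ} (hi : a i = 1) :
    linColength k a = linColength k (i.removeNth a) := by
  rw [linColength_eq_boxNullity_removeNth k i, hi, linColength]

theorem boxNullity_of_isEmpty {ι : Type*} [Fintype ι] [DecidableEq ι] [IsEmpty ι] (d a : ι → ℕ)
    {c : ℕ} (hc : 0 < c) : boxNullity k d a c = 1 := by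
  have hzero : boxShift k d a = 0 := LinearMap.ext fun f => Subtype.ext (funext fun j => by
    rw [coe_boxShift, diagShift_apply, Finset.univ_eq_empty, Finset.sum_empty]; rfl)
  rw [boxNullity, hzero, zero_pow hc.ne', LinearMap.ker_zero, finrank_top, finrank_box,
    Finset.univ_eq_empty, Finset.prod_empty]

theorem linColength_update (a : Fin (s + 1) → ℕ) (i : Fin (s + 1)) (c : ℕ) :
    linColength k (update a i c) = boxNullity k 1 (i.removeNth a) c := by
  rw [linColength_eq_boxNullity_removeNth k i, update_self, Fin.removeNth_update]

theorem linColength_vecCons_two {i : Fin (s + 1)} {a : Fin (s + 1) → ℕ} {n : ℕ}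
    (hi : a i = n + 1) (hn : (n : k) + 1 ≠ 0) :
    linColength k (Matrix.vecCons 2 a) =
      linColength k (update a i (n + 2)) + linColength k (update a i n) := by
  have hremove : (0 : Fin (s + 1)).removeNth (i.succ.removeNth (Matrix.vecCons 2 a)) =
      i.removeNth a := funext fun j => by
    simp only [Fin.removeNth, Fin.zero_succAbove, Fin.succ_succAbove_succ, Matrix.cons_val_succ]
  have htwo : i.succ.removeNth (Matrix.vecCons 2 a) 0 = 2 := by
    rw [Fin.removeNth, Fin.succ_succAbove_zero, Matrix.cons_val_zero]
  rw [linColength_eq_boxNullity_removeNth k i.succ, Matrix.cons_val_succ, hi,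
    boxNullity_removeNth_of_eq_two k htwo hn, hremove, linColength_update, linColength_update]

theorem linColength_singleton (p : ℕ) {a : Fin 1 → ℕ} (ha : a 0 ≤ p) :
    (linColength k a : ℤ) = middleCount p a := by
  rcases Nat.eq_zero_or_pos (a 0) with h0 | h0
  · rw [linColength_of_eq_zero k h0, middleCount_of_eq_zero p h0, Nat.cast_zero]
  · have hmid : ((∑ i, (a i : ℤ)) - (1 : ℕ)) / 2 = ((a 0 - 1) / 2 : ℕ) := by
      rw [Fin.sum_univ_one]
      omega
    rw [linColength_eq_boxNullity_removeNth k 0, boxNullity_of_isEmpty k _ _ h0, middleCount,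
      Fin.prod_univ_one, hmid, Int.cast_natCast, residueSum_geomPoly ha (by omega), Nat.cast_one]

theorem eq_zero_of_discrete_wave {A : Type*} [AddCommGroup A] {p : ℕ} {D : ℕ → ℕ → A}
    (hwave : ∀ x y, x + 1 < p → y + 1 < p →
      D (x + 2) (y + 1) + D x (y + 1) = D (x + 1) (y + 2) + D (x + 1) y)
    (hzero : ∀ y ≤ p, D 0 y = 0) (hone : ∀ y ≤ p, D 1 y = 0)
    (hbot : ∀ x ≤ p, D x 0 = 0) (htop : ∀ x ≤ p, D x p = 0) :
    ∀ x ≤ p, ∀ y ≤ p, D x y = 0 := by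
  intro x
  induction x using Nat.twoStepInduction with
  | zero => exact fun _ => hzero
  | one => exact fun _ => hone
  | more x ih ih' =>
    intro hx y hy
    rcases hy.eq_or_lt with rfl | hyp
    · exact htop _ hx
    cases y with
    | zero => exact hbot _ hx
    | succ y =>
      simpa only [ih (by omega) (y + 1) hy, ih' (by omega) (y + 2) hyp,
        ih' (by omega) y (by omega), add_zero] using hwave x y hx hyp

variable (p : ℕ) [CharP k p]

theorem natCast_add_one_ne_zero {n : ℕ} (hn : n + 1 < p) : (n : k) + 1 ≠ 0 := by
  rw [← Nat.cast_succ, Ne, CharP.cast_eq_zero_iff k p]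
  exact Nat.not_dvd_of_pos_of_lt n.succ_pos hn

theorem linColength_sub_middleCount_exchange {i j : Fin (s + 1)} {a : Fin (s + 1) → ℕ} {x y : ℕ}
    (hi : a i = x + 1) (hj : a j = y + 1) (hx : x + 1 < p) (hy : y + 1 < p) :
    (linColength k (update a i (x + 2)) - middleCount p (update a i (x + 2)) : ℤ) +
        (linColength k (update a i x) - middleCount p (update a i x)) =
      (linColength k (update a j (y + 2)) - middleCount p (update a j (y + 2))) +
        (linColength k (update a j y) - middleCount p (update a j y)) := by
  have hlin := (linColength_vecCons_two k hi (natCast_add_one_ne_zero k p hx)).symm.trans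
    (linColength_vecCons_two k hj (natCast_add_one_ne_zero k p hy))
  have hmid := (middleCount_update_add_two p hi).trans (middleCount_update_add_two p hj).symm
  omega

theorem linColength_eq_middleCount [Fact p.Prime] {s : ℕ} {a : Fin (s + 1) → ℕ}
    (ha : ∀ i, a i ≤ p) : (linColength k a : ℤ) = middleCount p a := by
  induction s with
  | zero => exact linColength_singleton k p (ha 0)
  | succ s ih =>
    have : NeZero p := ⟨(Fact.out : p.Prime).ne_zero⟩
    let b (x y : ℕ) : Fin (s + 2) → ℕ := update (update a 0 x) 1 y
    have hb0 (x y : ℕ) : b x y 0 = x :=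
      (update_of_ne Fin.zero_ne_one _ _).trans (update_self _ _ _)
    have hb1 (x y : ℕ) : b x y 1 = y := update_self _ _ _
    have hb {x y : ℕ} (hx : x ≤ p) (hy : y ≤ p) (i : Fin (s + 2)) : b x y i ≤ p := by
      simp only [b, update_apply]
      split_ifs <;> simp only [hx, hy, ha]
    have hcomm (x y c : ℕ) : update (b x y) 0 c = b c y := by
      rw [update_comm Fin.zero_ne_one.symm, update_idem]
    have hidem (x y c : ℕ) : update (b x y) 1 c = b x c := update_idem _ _ _
    suffices h : ∀ x ≤ p, ∀ y ≤ p, (linColength k (b x y) - middleCount p (b x y) : ℤ) = 0 by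
      simpa only [b, update_eq_self, sub_eq_zero] using h (a 0) (ha 0) (a 1) (ha 1)
    refine eq_zero_of_discrete_wave (fun x y hx hy => ?_) (fun y _ => ?_) (fun y hy => ?_)
      (fun x _ => ?_) (fun x hx => ?_)
    · simpa only [hcomm, hidem] using linColength_sub_middleCount_exchange k p
        (hb0 (x + 1) (y + 1)) (hb1 (x + 1) (y + 1)) hx hy
    · rw [linColength_of_eq_zero k (hb0 0 y), middleCount_of_eq_zero p (hb0 0 y)]; rfl
    · rw [linColength_of_eq_one k (hb0 1 y), middleCount_of_eq_one p (hb0 1 y),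
        ih (a := Fin.removeNth 0 (b 1 y)) fun i => hb (Fact.out : p.Prime).one_le hy _, sub_self]
    · rw [linColength_of_eq_zero k (hb1 x 0), middleCount_of_eq_zero p (hb1 x 0)]; rfl
    · rw [linColength_of_eq_char k p (hb1 x p) (hb hx le_rfl), middleCount_of_eq_self p (hb1 x p),
        Nat.cast_prod, sub_self]

end ExactFormula

section Coefficients

open Polynomial

/-- The coefficient of a polynomial in an integral degree, zero in negative degrees. -/
noncomputable def intCoeff (f : ℤ[X]) (n : ℤ) : ℤ := if 0 ≤ n then f.coeff n.toNat else 0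

theorem sum_support_ite_eq_intCoeff (f : ℤ[X]) (n : ℤ) :
    ∑ m ∈ f.support, (if (m : ℤ) = n then f.coeff m else 0) = intCoeff f n := by
  rw [intCoeff]
  split_ifs with hn
  · lift n to ℕ using hn
    simp only [Nat.cast_inj, Finset.sum_ite_eq', Int.toNat_natCast]
    exact ite_eq_left_iff.2 fun h => (notMem_support_iff.1 h).symm
  · exact Finset.sum_eq_zero fun m _ => if_neg fun h => hn (by omega)

theorem ite_natCast_eq_intCast_eq_sum {p : ℕ} [NeZero p] {m B : ℕ} {c : ℤ}
    (hm : |(m : ℤ) - c| ≤ B * p) (x : ℤ) :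
    (if (m : ZMod p) = c then x else 0) =
      ∑ l ∈ Finset.Icc (-B : ℤ) B, if (m : ℤ) = c + l * p then x else 0 := by
  have hp : (0 : ℤ) < p := Nat.cast_pos.2 (Nat.pos_of_neZero p)
  have hiff : (m : ZMod p) = c ↔ (p : ℤ) ∣ m - c := by
    rw [← ZMod.intCast_eq_intCast_iff_dvd_sub, Int.cast_natCast, eq_comm]
  split_ifs with h
  · obtain ⟨l, hl⟩ := hiff.1 h
    have hlB : l ∈ Finset.Icc (-B : ℤ) B := by
      rw [hl, abs_mul, abs_of_pos hp, mul_comm] at hm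
      exact Finset.mem_Icc.2 (abs_le.1 (le_of_mul_le_mul_right hm hp))
    rw [Finset.sum_eq_single_of_mem l hlB, if_pos (by linarith)]
    refine fun l' _ hne => if_neg fun h' => hne (mul_left_cancel₀ hp.ne' ?_)
    linarith
  · refine (Finset.sum_eq_zero fun l _ => if_neg fun h' => h (hiff.2 ⟨l, ?_⟩)).symm
    linarith

theorem residueSum_eq_sum_intCoeff (p : ℕ) [NeZero p] {f : ℤ[X]} {c : ℤ} {B : ℕ}
    (hf : ∀ m ∈ f.support, |(m : ℤ) - c| ≤ B * p) :
    residueSum p (c : ZMod p) f = ∑ l ∈ Finset.Icc (-B : ℤ) B, intCoeff f (c + l * p) := by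
  have hsupport : residueSum p (c : ZMod p) f =
      ∑ m ∈ f.support, if (m : ZMod p) = c then f.coeff m else 0 := by
    rw [residueSum, lsum_apply, Polynomial.sum]
    refine Finset.sum_congr rfl fun m _ => ?_
    split_ifs <;> rfl
  rw [hsupport, Finset.sum_congr rfl fun m hm => ite_natCast_eq_intCast_eq_sum (hf m hm) _,
    Finset.sum_comm]
  simp only [sum_support_ite_eq_intCoeff]

/-- The number of points with nonnegative integral coordinates of sum `n` in dimension `t + 1`,
which is the coefficient of `X ^ n` in `(1 - X) ^ (-(t + 1))`. -/
def simplexCount (t : ℕ) (n : ℤ) : ℤ := if 0 ≤ n then ((t + n.toNat).choose t : ℤ) else 0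

theorem coeff_X_pow_mul_mk_choose (t k n : ℕ) :
    (PowerSeries.X ^ k * PowerSeries.mk fun j => ((t + j).choose t : ℤ)).coeff n =
      simplexCount t (n - k) := by
  rw [PowerSeries.coeff_X_pow_mul', simplexCount]
  split_ifs with h h' h'
  · rw [PowerSeries.coeff_mk, ← Nat.cast_sub h, Int.toNat_natCast]
  · omega
  · omega
  · rfl

theorem prod_one_sub_X_pow {ι : Type*} [Fintype ι] [DecidableEq ι] (a : ι → ℕ) :
    (∏ i, (1 - X ^ a i) : ℤ[X]) = ∑ ε : ι → ℤˣ,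
      C (∏ i, (ε i : ℤ)) * X ^ (∑ i, if ε i = 1 then 0 else a i) := by
  have hfactor (i : ι) : (1 - X ^ a i : ℤ[X]) =
      ∑ e : ℤˣ, C (e : ℤ) * X ^ (if e = 1 then 0 else a i) := by
    rw [UnitsInt.univ, Finset.sum_pair (by decide), if_pos rfl, if_neg (by decide), Units.val_one,
      Units.val_neg, Units.val_one, C_neg, C_1, pow_zero, one_mul, neg_one_mul, ← sub_eq_add_neg]
  simp_rw [hfactor, Finset.prod_univ_sum, Fintype.piFinset_univ, Finset.prod_mul_distrib, map_prod,
    Finset.prod_pow_eq_pow_sum]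

theorem coe_prod_geomPoly {t : ℕ} (a : Fin (t + 1) → ℕ) :
    ((∏ i, geomPoly (a i) : ℤ[X]) : PowerSeries ℤ) =
      ((∏ i, (1 - X ^ a i) : ℤ[X]) : PowerSeries ℤ) *
        PowerSeries.mk fun n => ((t + n).choose t : ℤ) := by
  have hprod : (∏ i, (1 - X ^ a i) : ℤ[X]) = (∏ i, geomPoly (a i)) * (1 - X) ^ (t + 1) := by
    simp only [← geomPoly_mul_one_sub, Finset.prod_mul_distrib, Finset.prod_const,
      Finset.card_univ, Fintype.card_fin]
  rw [hprod, coe_mul, coe_pow, coe_sub, coe_one, coe_X, mul_assoc, mul_comm (_ ^ _),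
    PowerSeries.mk_add_choose_mul_one_sub_pow_eq_one, mul_one]

theorem intCoeff_prod_geomPoly {t : ℕ} (a : Fin (t + 1) → ℕ) (n : ℤ) :
    intCoeff (∏ i, geomPoly (a i)) n = ∑ ε : Fin (t + 1) → ℤˣ,
      (∏ i, (ε i : ℤ)) * simplexCount t (n - ∑ i, if ε i = 1 then (0 : ℤ) else a i) := by
  have hcast (ε : Fin (t + 1) → ℤˣ) : (∑ i, if ε i = 1 then (0 : ℤ) else a i) =
      (∑ i, if ε i = 1 then 0 else a i : ℕ) := by
    push_cast; rfl
  simp only [hcast]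
  rw [intCoeff]
  split_ifs with hn
  · lift n to ℕ using hn
    rw [Int.toNat_natCast, ← coeff_coe, coe_prod_geomPoly, prod_one_sub_X_pow,
      ← coeToPowerSeries.ringHom_apply, map_sum, Finset.sum_mul, map_sum]
    refine Finset.sum_congr rfl fun ε _ => ?_
    rw [coeToPowerSeries.ringHom_apply, coe_mul, coe_C, coe_pow, coe_X, mul_assoc,
      PowerSeries.coeff_C_mul, coeff_X_pow_mul_mk_choose]
  · refine (Finset.sum_eq_zero fun ε _ => ?_).symm
    rw [simplexCount, if_neg (by omega), mul_zero]

end Coefficients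

section SignSums

open Function

theorem sum_prod_sign_mul_eq_zero {ι R : Type*} [Fintype ι] [DecidableEq ι] [CommRing R] (i : ι)
    {g : (ι → ℤˣ) → R} (hg : ∀ ε, g (ε * Pi.mulSingle i (-1)) = g ε) :
    ∑ ε : ι → ℤˣ, (∏ j, ((ε j : ℤ) : R)) * g ε = 0 := by
  have hcoe (ε : ι → ℤˣ) : ∏ j, ((ε j : ℤ) : R) = ((∏ j, ε j : ℤˣ) : ℤ) := by push_cast; rfl
  have hflip (ε : ι → ℤˣ) : ∏ j, (ε * Pi.mulSingle i (-1) : ι → ℤˣ) j = -∏ j, ε j := by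
    simp only [Pi.mul_apply, Finset.prod_mul_distrib, Finset.prod_pi_mulSingle', Finset.mem_univ,
      if_true, mul_neg_one]
  simp only [hcoe]
  refine Finset.sum_involution (fun ε _ => ε * Pi.mulSingle i (-1)) (fun ε _ => ?_)
    (fun ε _ _ h => ?_) (fun _ _ => Finset.mem_univ _) fun ε _ => ?_
  · rw [hg, hflip, Units.val_neg, Int.cast_neg, neg_mul, add_neg_cancel]
  · exact absurd ((Pi.mulSingle_eq_one_iff (M := fun _ => ℤˣ)).1 (mul_eq_left.1 h)) (by decide)
  · rw [mul_assoc, ← Pi.mulSingle_mul, neg_mul_neg, one_mul, Pi.mulSingle_one, mul_one]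

theorem sum_prod_sign_mul_pow_eq_zero {ι R : Type*} [Fintype ι] [DecidableEq ι] [CommRing R]
    (α : ι → R) (c : R) {m : ℕ} (hm : m < Fintype.card ι) :
    ∑ ε : ι → ℤˣ, (∏ i, ((ε i : ℤ) : R)) * ((∑ i, ((ε i : ℤ) : R) * α i) + c) ^ m = 0 := by
  have hoption (ε : ι → ℤˣ) : (∑ i, ((ε i : ℤ) : R) * α i) + c =
      ∑ o : Option ι, o.elim c fun i => ((ε i : ℤ) : R) * α i := by
    rw [Fintype.sum_option, add_comm]; rfl
  simp_rw [hoption, Fintype.sum_pow, Finset.mul_sum]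
  rw [Finset.sum_comm]
  -- A monomial of degree `m < card ι` does not involve some sign `ε i`.
  refine Finset.sum_eq_zero fun g _ => ?_
  obtain ⟨i, hi⟩ : ∃ i : ι, ∀ x, g x ≠ some i := by
    by_contra! h
    choose x hx using h
    have hinj : Injective x := fun i j hij =>
      Option.some_injective _ ((hx i).symm.trans ((congrArg g hij).trans (hx j)))
    exact (Fintype.card_le_of_injective x hinj).not_gt (by rwa [Fintype.card_fin])
  refine sum_prod_sign_mul_eq_zero i fun ε => Finset.prod_congr rfl fun x _ => ?_
  rcases hx : g x with _ | j
  · rfl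
  · have hj : j ≠ i := fun h => hi x (h ▸ hx)
    rw [Option.elim_some, Option.elim_some, Pi.mul_apply, Pi.mulSingle_eq_of_ne hj, mul_one]

theorem pow_eq_max_pow_add (y : ℝ) {t : ℕ} (ht : 0 < t) :
    y ^ t = max y 0 ^ t + (-1) ^ t * max (-y) 0 ^ t := by
  rcases le_total y 0 with h | h
  · rw [max_eq_right h, max_eq_left (neg_nonneg.2 h), ← mul_pow, zero_pow ht.ne', zero_add,
      neg_one_mul, neg_neg]
  · rw [max_eq_left h, max_eq_right (neg_nonpos.2 h), zero_pow ht.ne', mul_zero, add_zero]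

theorem finsum_of_even {M : Type*} [AddCommMonoid M] {f : ℤ → M} (hf : (support f).Finite)
    (heven : ∀ l, f (-l) = f l) :
    ∑ᶠ l : ℤ, f l = f 0 + 2 • ∑ᶠ (l : ℤ) (_ : 0 < l), f l := by
  have huniv : (Set.univ : Set ℤ) = insert 0 (Set.Ioi 0 ∪ Set.Iio 0) := by
    rw [Set.union_comm, Set.Iio_union_Ioi, Set.insert_eq, Set.union_compl_self]
  have hneg : ∑ᶠ l ∈ Set.Iio (0 : ℤ), f l = ∑ᶠ l ∈ Set.Ioi (0 : ℤ), f l := by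
    rw [← neg_zero, ← Set.image_neg_Ioi, finsum_mem_image neg_injective.injOn]
    simp only [heven, neg_zero]
  have hdisjoint : Disjoint (Set.Ioi (0 : ℤ)) (Set.Iio 0) :=
    Set.disjoint_left.2 fun _ h h' => lt_asymm (Set.mem_Ioi.1 h) h'
  rw [← finsum_mem_univ, huniv,
    finsum_mem_insert' _ (by simp only [Set.mem_union, Set.mem_Ioi, Set.mem_Iio, lt_self_iff_false,
      or_self, not_false_eq_true]) (hf.subset Set.inter_subset_right),
    finsum_mem_union' hdisjoint (hf.subset Set.inter_subset_right)
      (hf.subset Set.inter_subset_right), hneg, ← two_nsmul]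
  rfl

variable {t : ℕ}

theorem signSum_eq_sum_max (ht : 0 < t) (d : Fin (t + 1) → ℕ) (l : ℤ) :
    signSum d l = ∑ ε : Fin (t + 1) → ℤˣ, (∏ i, ((ε i : ℤ) : ℝ)) *
      max ((∑ i, ((ε i : ℤ) : ℝ) / d i) - 2 * l) 0 ^ t := by
  rw [signSum, Finset.sum_filter]
  refine Finset.sum_congr rfl fun ε _ => ?_
  split_ifs with h
  · rw [max_eq_left (sub_pos.2 h).le, Nat.add_sub_cancel]
  · rw [max_eq_right (sub_nonpos.2 (not_lt.1 h)), zero_pow ht.ne', mul_zero]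

theorem signSum_neg_eq_neg_sum_max (ht : 0 < t) (d : Fin (t + 1) → ℕ) (l : ℤ) :
    signSum d (-l) = -∑ ε : Fin (t + 1) → ℤˣ, (∏ i, ((ε i : ℤ) : ℝ)) *
      ((-1) ^ t * max (-((∑ i, ((ε i : ℤ) : ℝ) / d i) - 2 * l)) 0 ^ t) := by
  rw [signSum_eq_sum_max ht, ← Equiv.sum_comp (Equiv.neg _), ← Finset.sum_neg_distrib]
  refine Finset.sum_congr rfl fun ε _ => ?_
  simp only [Equiv.neg_apply, Pi.neg_apply, Units.val_neg, Int.cast_neg, Finset.prod_neg, neg_div,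
    Finset.sum_neg_distrib, Finset.card_univ, Fintype.card_fin, mul_neg, sub_neg_eq_add, neg_sub]
  rw [neg_add_eq_sub]
  ring

theorem signSum_neg (ht : 0 < t) (d : Fin (t + 1) → ℕ) (l : ℤ) : signSum d (-l) = signSum d l := by
  have hzero := sum_prod_sign_mul_pow_eq_zero (fun i => ((d i : ℝ))⁻¹) (-(2 * (l : ℝ)))
    (by rw [Fintype.card_fin]; exact Nat.lt_succ_self t)
  simp only [← div_eq_mul_inv, ← sub_eq_add_neg] at hzero
  rw [Finset.sum_congr rfl fun ε _ => by rw [pow_eq_max_pow_add _ ht, mul_add],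
    Finset.sum_add_distrib, ← signSum_eq_sum_max ht] at hzero
  rw [signSum_neg_eq_neg_sum_max ht, eq_neg_of_add_eq_zero_left hzero]

theorem signSum_eq_zero_of_lt_abs (ht : 0 < t) (d : Fin (t + 1) → ℕ) {l : ℤ}
    (hl : ((t + 1 : ℕ) : ℤ) < |l|) : signSum d l = 0 := by
  wlog h : 0 ≤ l generalizing l
  · rw [← signSum_neg ht]
    exact this (by rwa [abs_neg]) (by omega)
  rw [abs_of_nonneg h] at hl
  rw [signSum, Finset.filter_false_of_mem, Finset.sum_empty]
  intro ε _
  have hterm (i : Fin (t + 1)) : ((ε i : ℤ) : ℝ) / d i ≤ 1 := by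
    refine (le_abs_self _).trans ?_
    rw [abs_div, Nat.abs_cast, ← Int.cast_abs, Int.isUnit_iff_abs_eq.1 (ε i).isUnit, Int.cast_one,
      one_div]
    exact Nat.cast_inv_le_one _
  have hsum : ∑ i, ((ε i : ℤ) : ℝ) / d i ≤ (t + 1 : ℕ) := by
    simpa only [Finset.sum_const, Finset.card_univ, Fintype.card_fin, nsmul_one] using
      Finset.sum_le_sum fun i (_ : i ∈ Finset.univ) => hterm i
  have hl' : ((t + 1 : ℕ) : ℝ) < l := by exact_mod_cast hl
  linarith [Int.cast_nonneg (R := ℝ) h]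

theorem support_signSum_subset (ht : 0 < t) (d : Fin (t + 1) → ℕ) :
    support (signSum d) ⊆ Finset.Icc (-(t + 1 : ℕ) : ℤ) (t + 1 : ℕ) := by
  intro l hl
  rw [Finset.coe_Icc, Set.mem_Icc, ← abs_le]
  exact not_lt.1 fun h => hl (signSum_eq_zero_of_lt_abs ht d h)

theorem finite_support_signSum (ht : 0 < t) (d : Fin (t + 1) → ℕ) : (support (signSum d)).Finite :=
  (Finset.finite_toSet _).subset (support_signSum_subset ht d)

theorem finsum_signSum_eq (ht : 0 < t) (d : Fin (t + 1) → ℕ) :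
    ∑ᶠ l : ℤ, signSum d l = signSum d 0 + 2 * ∑ᶠ (l : ℤ) (_ : 0 < l), signSum d l := by
  rw [finsum_of_even (finite_support_signSum ht d) (signSum_neg ht d), nsmul_eq_mul, Nat.cast_ofNat]

end SignSums

section Limit

open Filter Topology

theorem intDiv_bounds (n : ℤ) (m : ℕ) :
    (n : ℝ) / m - 1 ≤ (n / m : ℤ) ∧ ((n / m : ℤ) : ℝ) ≤ n / m := by
  rw [← Int.floor_intCast (R := ℝ) n, ← Int.floor_div_natCast, Int.floor_intCast]
  exact ⟨(Int.sub_one_lt_floor _).le, Int.floor_le _⟩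

theorem tendsto_intDiv_div_natCast {u : ℕ → ℤ} {x : ℝ} (m : ℕ)
    (hu : Tendsto (fun n => (u n : ℝ) / n) atTop (𝓝 x)) :
    Tendsto (fun n => ((u n / m : ℤ) : ℝ) / n) atTop (𝓝 (x / m)) := by
  have hlower := (hu.div_const (m : ℝ)).sub (tendsto_const_div_atTop_nhds_zero_nat (1 : ℝ))
  rw [sub_zero] at hlower
  refine tendsto_of_tendsto_of_tendsto_of_le_of_le hlower (hu.div_const m) (fun n => ?_)
    fun n => ?_
  · rw [div_right_comm, ← sub_div]
    exact div_le_div_of_nonneg_right (intDiv_bounds _ _).1 n.cast_nonneg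
  · rw [div_right_comm]
    exact div_le_div_of_nonneg_right (intDiv_bounds _ _).2 n.cast_nonneg

theorem tendsto_natCast_div_self : Tendsto (fun n : ℕ => (n : ℝ) / n) atTop (𝓝 1) :=
  tendsto_const_nhds.congr' <| (eventually_gt_atTop 0).mono fun _ hn =>
    (div_self (Nat.cast_ne_zero.2 hn.ne')).symm

theorem tendsto_natDiv_div_natCast (m : ℕ) :
    Tendsto (fun n : ℕ => ((n / m : ℕ) : ℝ) / n) atTop (𝓝 (m : ℝ)⁻¹) := by
  simpa only [one_div, ← Int.natCast_div, Int.cast_natCast] using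
    tendsto_intDiv_div_natCast (u := fun n => n) m tendsto_natCast_div_self

theorem simplexCount_bounds {t : ℕ} (ht : 0 < t) (n : ℤ) :
    max (n : ℝ) 0 ^ t / t.factorial ≤ simplexCount t n ∧
      (simplexCount t n : ℝ) ≤ (max (n : ℝ) 0 + t) ^ t / t.factorial := by
  have hfact : (0 : ℝ) < t.factorial := Nat.cast_pos.2 t.factorial_pos
  rw [simplexCount]
  split_ifs with hn
  · lift n to ℕ using hn
    have hlower : n ^ t ≤ (n + 1).ascFactorial t :=
      (Nat.pow_le_pow_left n.le_succ t).trans (Nat.pow_succ_le_ascFactorial _ _)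
    have hupper := Nat.ascFactorial_le_pow_add n t
    rw [Nat.ascFactorial_eq_factorial_mul_choose, add_comm n t, mul_comm] at hlower hupper
    rw [Int.cast_natCast, Int.cast_natCast, Int.toNat_natCast, max_eq_left n.cast_nonneg,
      div_le_iff₀ hfact, le_div_iff₀ hfact, add_comm (n : ℝ)]
    exact_mod_cast And.intro hlower hupper
  · rw [max_eq_right (Int.cast_nonpos.2 (not_le.1 hn).le), zero_pow ht.ne', zero_div, Int.cast_zero]
    exact ⟨le_rfl, by positivity⟩

theorem tendsto_simplexCount {t : ℕ} (ht : 0 < t) {u : ℕ → ℤ} {x : ℝ}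
    (hu : Tendsto (fun n => (u n : ℝ) / n) atTop (𝓝 x)) :
    Tendsto (fun n => (simplexCount t (u n) : ℝ) / (n : ℝ) ^ t) atTop
      (𝓝 (max x 0 ^ t / t.factorial)) := by
  have hmax : Tendsto (fun n => max (u n : ℝ) 0 / n) atTop (𝓝 (max x 0)) := by
    simpa only [← max_div_div_right (Nat.cast_nonneg _), zero_div] using hu.max tendsto_const_nhds
  have hmax' : Tendsto (fun n => (max (u n : ℝ) 0 + t) / n) atTop (𝓝 (max x 0)) := by
    simpa only [add_div, add_zero] using
      hmax.add (tendsto_const_div_atTop_nhds_zero_nat (t : ℝ))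
  refine tendsto_of_tendsto_of_tendsto_of_le_of_le ((hmax.pow t).div_const _)
    ((hmax'.pow t).div_const _) (fun n => ?_) fun n => ?_
  · rw [div_pow, div_right_comm]
    exact div_le_div_of_nonneg_right (simplexCount_bounds ht _).1 (by positivity)
  · rw [div_pow, div_right_comm]
    exact div_le_div_of_nonneg_right (simplexCount_bounds ht _).2 (by positivity)

/-- The degree `⌊∑ (a i - 1) / 2⌋ + l * p - ∑ a i`, the last sum over the `i` with `ε i = -1`, at
which the generating function `(1 - X) ^ (-s)` contributes to `middleCount p a`. -/
def middleDegree (p : ℕ) {s : ℕ} (a : Fin s → ℕ) (ε : Fin s → ℤˣ) (l : ℤ) : ℤ :=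
  ((∑ i, (a i : ℤ)) - s) / 2 + l * p - ∑ i, if ε i = 1 then (0 : ℤ) else a i

theorem natDegree_prod_geomPoly_le {ι : Type*} [Fintype ι] (a : ι → ℕ) :
    (∏ i, geomPoly (a i)).natDegree ≤ ∑ i, a i := by
  refine (Polynomial.natDegree_prod_le _ _).trans (Finset.sum_le_sum fun i _ => ?_)
  refine Polynomial.natDegree_sum_le_of_forall_le _ _ fun j hj => ?_
  rw [Polynomial.natDegree_X_pow]
  exact (Finset.mem_range.1 hj).le

variable {t : ℕ}

theorem middleCount_eq_sum_simplexCount {p : ℕ} (hp : 2 ≤ p) {a : Fin (t + 1) → ℕ}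
    (ha : ∀ i, a i ≤ p) :
    middleCount p a = ∑ l ∈ Finset.Icc (-(t + 1 : ℕ) : ℤ) (t + 1 : ℕ), ∑ ε : Fin (t + 1) → ℤˣ,
      (∏ i, (ε i : ℤ)) * simplexCount t (middleDegree p a ε l) := by
  have : NeZero p := ⟨by omega⟩
  rw [middleCount, residueSum_eq_sum_intCoeff p (B := t + 1)]
  · simp only [intCoeff_prod_geomPoly, middleDegree]
  · intro m hm
    have hm' : m ≤ ∑ i, a i :=
      (Polynomial.le_natDegree_of_mem_supp m hm).trans (natDegree_prod_geomPoly_le a)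
    have hsum : ∑ i, a i ≤ (t + 1) * p := by
      simpa only [Finset.sum_const, Finset.card_univ, Fintype.card_fin, smul_eq_mul] using
        Finset.sum_le_sum fun i (_ : i ∈ Finset.univ) => ha i
    have htwo : (t + 1) * 2 ≤ (t + 1) * p := Nat.mul_le_mul_left _ hp
    rw [← Nat.cast_sum, ← Nat.cast_mul, abs_le]
    omega

theorem middleDegree_limit_eq {ι : Type*} [Fintype ι] (d : ι → ℕ) (ε : ι → ℤˣ) (l : ℤ) :
    (∑ i, (d i : ℝ)⁻¹) / 2 + l - (∑ i, if ε i = 1 then 0 else (d i : ℝ)⁻¹) =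
      ((∑ i, ((ε i : ℤ) : ℝ) / d i) - 2 * (-l : ℤ)) / 2 := by
  have hsign (i : ι) : ((ε i : ℤ) : ℝ) / d i =
      (d i : ℝ)⁻¹ - 2 * if ε i = 1 then 0 else (d i : ℝ)⁻¹ := by
    split_ifs with h
    · rw [h, Units.val_one, Int.cast_one, mul_zero, sub_zero, one_div]
    · rw [(Int.units_eq_one_or (ε i)).resolve_left h, Units.val_neg, Units.val_one, Int.cast_neg,
        Int.cast_one]
      ring
  simp only [hsign, Finset.sum_sub_distrib, ← Finset.mul_sum, Int.cast_neg]
  ring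

theorem tendsto_middleDegree {s : ℕ} (d : Fin s → ℕ) (ε : Fin s → ℤˣ) (l : ℤ) :
    Tendsto (fun p : ℕ => (middleDegree p (fun i => p / d i) ε l : ℝ) / p) atTop
      (𝓝 (((∑ i, ((ε i : ℤ) : ℝ) / d i) - 2 * (-l : ℤ)) / 2)) := by
  have hdiv (i : Fin s) := tendsto_natDiv_div_natCast (d i)
  have hhalf := tendsto_intDiv_div_natCast
    (u := fun p => (∑ i, ((p / d i : ℕ) : ℤ)) - s) (x := ∑ i, (d i : ℝ)⁻¹) 2 <| by
      simpa only [Int.cast_sub, Int.cast_sum, Int.cast_natCast, sub_div, Finset.sum_div, sub_zero]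
        using (tendsto_finsetSum _ fun i _ => hdiv i).sub
          (tendsto_const_div_atTop_nhds_zero_nat (s : ℝ))
  have hshift : Tendsto (fun p : ℕ => (l * p : ℝ) / p) atTop (𝓝 l) := by
    simpa only [mul_div_assoc, mul_one] using tendsto_natCast_div_self.const_mul (l : ℝ)
  have hminus : Tendsto (fun p : ℕ => ∑ i, (if ε i = 1 then (0 : ℝ) else (p / d i : ℕ)) / p) atTop
      (𝓝 (∑ i, if ε i = 1 then (0 : ℝ) else (d i : ℝ)⁻¹)) := by
    refine tendsto_finsetSum _ fun i _ => ?_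
    split_ifs
    · simpa only [zero_div] using tendsto_const_nhds
    · exact hdiv i
  have hall := (hhalf.add hshift).sub hminus
  simp only [Nat.cast_ofNat, middleDegree_limit_eq] at hall
  simpa only [middleDegree, Int.cast_sub, Int.cast_add, Int.cast_mul, Int.cast_sum, Int.cast_ite,
    Int.cast_natCast, Int.cast_zero, add_div, sub_div, Finset.sum_div] using hall

theorem finsum_signSum_eq_sum_max (ht : 0 < t) (d : Fin (t + 1) → ℕ) :
    (2 : ℝ) ^ (1 - ((t + 1 : ℕ) : ℤ)) / t.factorial * ∑ᶠ l : ℤ, signSum d l =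
      ∑ l ∈ Finset.Icc (-(t + 1 : ℕ) : ℤ) (t + 1 : ℕ), ∑ ε : Fin (t + 1) → ℤˣ,
        (∏ i, ((ε i : ℤ) : ℝ)) *
          (max (((∑ i, ((ε i : ℤ) : ℝ) / d i) - 2 * (-l : ℤ)) / 2) 0 ^ t / t.factorial) := by
  have hpow : (2 : ℝ) ^ (1 - ((t + 1 : ℕ) : ℤ)) = (2 ^ t)⁻¹ := by
    rw [Nat.cast_succ, sub_add_cancel_right, zpow_neg, zpow_natCast]
  have hmax (x : ℝ) : max (x / 2) 0 = max x 0 / 2 := by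
    rw [← max_div_div_right zero_le_two, zero_div]
  rw [finsum_eq_sum_of_support_subset _ (support_signSum_subset ht d), Finset.mul_sum]
  refine Finset.sum_congr rfl fun l _ => ?_
  rw [← signSum_neg ht, signSum_eq_sum_max ht, Finset.mul_sum]
  refine Finset.sum_congr rfl fun ε _ => ?_
  rw [hpow, hmax, div_pow]
  ring

theorem tendsto_middleCount (ht : 0 < t) (d : Fin (t + 1) → ℕ) :
    Tendsto (fun p : ℕ => (middleCount p (fun i => p / d i) : ℝ) / (p : ℝ) ^ t) atTop
      (𝓝 ((2 : ℝ) ^ (1 - ((t + 1 : ℕ) : ℤ)) / t.factorial * ∑ᶠ l : ℤ, signSum d l)) := by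
  rw [finsum_signSum_eq_sum_max ht]
  refine (tendsto_finsetSum _ fun l _ => tendsto_finsetSum _ fun ε _ =>
    (tendsto_simplexCount ht (tendsto_middleDegree d ε l)).const_mul _).congr' ?_
  filter_upwards [eventually_ge_atTop 2] with p hp
  rw [middleCount_eq_sum_simplexCount hp fun i => Nat.div_le_self p (d i)]
  push_cast
  simp only [Finset.sum_div, mul_div_assoc]

end Limit

section Multiplicity

open Filter Topology

theorem exists_ge_of_le_add_geometric {v : ℕ → ℝ} {C r : ℝ} (hr : r < 1)
    (hmono : ∀ n, v n ≤ v (n + 1)) (hv : ∀ n, v (n + 1) ≤ v n + C * r ^ n) :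
    ∃ y, ∀ n, v n ≤ y ∧ y ≤ v n + C * r ^ n / (1 - r) := by
  have hdist (n : ℕ) : dist (v n) (v (n + 1)) ≤ C * r ^ n := by
    rw [dist_comm, Real.dist_eq, abs_of_nonneg (sub_nonneg.2 (hmono n))]
    exact sub_le_iff_le_add'.2 (hv n)
  obtain ⟨y, hy⟩ := cauchySeq_tendsto_of_complete (cauchySeq_of_le_geometric r C hr hdist)
  refine ⟨y, fun n => ⟨(monotone_nat_of_le_succ hmono).ge_of_tendsto hy n, ?_⟩⟩
  have hlast := dist_le_of_le_geometric_of_tendsto r C hr hdist hy n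
  rw [dist_comm, Real.dist_eq] at hlast
  exact sub_le_iff_le_add'.1 ((le_abs_self _).trans hlast)

theorem linColength_le_add_mul (k : Type*) [Field k] {t : ℕ} {a b : Fin (t + 2) → ℕ}
    (hab : a ≤ b) {c N : ℕ} (hc : ∀ i, b i ≤ a i + c) (hN : ∀ i, b i ≤ N) :
    linColength k b ≤ linColength k a + (t + 2) * c * N ^ t := by
  refine (linColength_le_add_sum_mul k hab hN).trans ?_
  gcongr
  simpa only [Finset.sum_const, Finset.card_univ, Fintype.card_fin, smul_eq_mul] using
    Finset.sum_le_sum fun i (_ : i ∈ Finset.univ) => tsub_le_iff_left.2 (hc i)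

variable {t : ℕ} (p : ℕ) [hp : Fact p.Prime] (d : Fin (t + 2) → ℕ)

/-- The colength of the linear form `∑ X i` for the exponents `⌊p ^ n / d i⌋`, divided by
`p ^ (n * (t + 1))`. -/
noncomputable def normalizedColength (n : ℕ) : ℝ :=
  linColength (ZMod p) (fun i => p ^ n / d i) / ((p : ℝ) ^ n) ^ (t + 1)

variable {d}

theorem normalizedColength_pos (hd : ∀ i, 0 < d i) {n : ℕ} (hn : ∀ i, d i ≤ p ^ n) :
    0 < normalizedColength p d n := by
  have hp0 : (0 : ℝ) < p := Nat.cast_pos.2 hp.out.pos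
  have hlin := linColength_pos (ZMod p) fun i => Nat.div_pos (hn i) (hd i)
  rw [normalizedColength]
  positivity

theorem linColength_div_succ_bounds (hd : ∀ i, 0 < d i) (n : ℕ) :
    p ^ (t + 1) * linColength (ZMod p) (fun i => p ^ n / d i) ≤
        linColength (ZMod p) (fun i => p ^ (n + 1) / d i) ∧
      linColength (ZMod p) (fun i => p ^ (n + 1) / d i) ≤
        p ^ (t + 1) * linColength (ZMod p) (fun i => p ^ n / d i) +
          (t + 2) * p * (p ^ (n + 1)) ^ t := by
  have hle : (p • fun i => p ^ n / d i) ≤ fun i => p ^ (n + 1) / d i := fun i => by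
    simpa only [pow_succ', Pi.smul_apply, smul_eq_mul] using
      Nat.mul_div_le_mul_div_assoc p (p ^ n) (d i)
  have hge (i : Fin (t + 2)) : p ^ (n + 1) / d i ≤ (p • fun i => p ^ n / d i) i + p := by
    refine Nat.div_le_of_le_mul ?_
    calc p ^ (n + 1) = p * p ^ n := pow_succ' p n
      _ ≤ p * (d i * (p ^ n / d i + 1)) :=
        Nat.mul_le_mul_left p (Nat.lt_mul_div_succ _ (hd i)).le
      _ = d i * (p * (p ^ n / d i) + p) := by ring
  rw [← linColength_char_smul]
  exact ⟨linColength_mono _ hle, linColength_le_add_mul _ hle hge fun i => Nat.div_le_self _ _⟩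

theorem normalizedColength_succ_bounds (hd : ∀ i, 0 < d i) (n : ℕ) :
    normalizedColength p d n ≤ normalizedColength p d (n + 1) ∧
      normalizedColength p d (n + 1) ≤
        normalizedColength p d n + (t + 2 : ℕ) * (p : ℝ)⁻¹ ^ n := by
  have hp0 : (0 : ℝ) < p := Nat.cast_pos.2 hp.out.pos
  obtain ⟨hlower, hupper⟩ := linColength_div_succ_bounds p hd n
  have hscale : ((p : ℝ) ^ (n + 1)) ^ (t + 1) = p ^ (t + 1) * (p ^ n) ^ (t + 1) := by
    rw [pow_succ' (p : ℝ) n, mul_pow]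
  have herror : (t + 2 : ℕ) * (p : ℝ)⁻¹ ^ n * (p ^ (n + 1)) ^ (t + 1) =
      (t + 2 : ℕ) * p * (p ^ (n + 1)) ^ t := by
    rw [pow_succ _ t, pow_succ' (p : ℝ) n, inv_pow]
    field_simp
  constructor
  · rw [normalizedColength, normalizedColength, hscale, ← mul_div_mul_left _ _ (pow_pos hp0 _).ne']
    gcongr
    exact_mod_cast hlower
  · rw [normalizedColength, div_le_iff₀ (by positivity), add_mul, herror, hscale,
      normalizedColength, mul_left_comm, div_mul_cancel₀ _ (by positivity)]
    exact_mod_cast hupper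

theorem exists_limit_normalizedColength (hd : ∀ i, 0 < d i) :
    ∃ y, 0 < y ∧ ∀ n, |normalizedColength p d n - y| ≤ 2 * (t + 2 : ℕ) * (p : ℝ)⁻¹ ^ n := by
  have hp2 : (p : ℝ)⁻¹ ≤ 2⁻¹ := inv_anti₀ two_pos (Nat.ofNat_le_cast.2 hp.out.two_le)
  obtain ⟨y, hy⟩ := exists_ge_of_le_add_geometric (hp2.trans_lt (by norm_num))
    (fun n => (normalizedColength_succ_bounds p hd n).1)
    fun n => (normalizedColength_succ_bounds p hd n).2
  refine ⟨y, ?_, fun n => ?_⟩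
  · refine (normalizedColength_pos p hd fun i => ?_).trans_le (hy (∑ i, d i)).1
    exact (Finset.single_le_sum (fun _ _ => Nat.zero_le _) (Finset.mem_univ i)).trans
      (Nat.lt_pow_self hp.out.one_lt).le
  · rw [abs_sub_comm, abs_of_nonneg (sub_nonneg.2 (hy n).1), sub_le_iff_le_add', mul_assoc,
      mul_comm]
    refine (hy n).2.trans (add_le_add_right ?_ _)
    rw [div_le_iff₀ (by linarith), mul_assoc]
    exact le_mul_of_one_le_right (by positivity) (by linarith)

theorem linColength_residueBox_bounds (n : ℕ) (r : ∀ i, Fin (d i)) :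
    linColength (ZMod p) (fun i => p ^ n / d i) ≤
        linColength (ZMod p) (residueBox d (fun _ => p ^ n) r) ∧
      linColength (ZMod p) (residueBox d (fun _ => p ^ n) r) ≤
        linColength (ZMod p) (fun i => p ^ n / d i) + (t + 2) * (p ^ n) ^ t := by
  have hd (i : Fin (t + 2)) : 0 < d i := (Nat.zero_le _).trans_lt (r i).2
  have hle : (fun i => p ^ n / d i) ≤ residueBox d (fun _ => p ^ n) r := fun i =>
    Nat.div_le_div_right (by dsimp only; have := (r i).2; omega)
  have hge (i : Fin (t + 2)) : residueBox d (fun _ => p ^ n) r i ≤ p ^ n / d i + 1 :=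
    (residueBox_le_iff r i _).2 ((Nat.lt_mul_div_succ _ (hd i)).le.trans (Nat.le_add_left _ _))
  have hbox (i : Fin (t + 2)) : residueBox d (fun _ => p ^ n) r i ≤ p ^ n :=
    (residueBox_le_iff r i _).2
      ((Nat.le_mul_of_pos_left _ (hd i)).trans (Nat.le_add_left _ _))
  exact ⟨linColength_mono _ hle,
    by simpa only [mul_one] using linColength_le_add_mul (ZMod p) hle hge hbox⟩

theorem abs_sum_linColength_residueBox_sub_le (n : ℕ) :
    |((∑ r, linColength (ZMod p) (residueBox d (fun _ => p ^ n) r) : ℕ) : ℝ) -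
        (∏ i, d i : ℕ) * normalizedColength p d n * ((p : ℝ) ^ n) ^ (t + 1)| ≤
      (∏ i, d i : ℕ) * (t + 2 : ℕ) * ((p : ℝ) ^ n) ^ t := by
  have hp0 : (0 : ℝ) < p := Nat.cast_pos.2 hp.out.pos
  have hcard : (∏ i, d i : ℕ) = (Finset.univ : Finset (∀ i, Fin (d i))).card := by
    rw [Finset.card_univ, Fintype.card_pi]
    simp only [Fintype.card_fin]
  have hlower := Finset.card_nsmul_le_sum Finset.univ _ _
    fun r _ => (linColength_residueBox_bounds (d := d) p n r).1
  have hupper := Finset.sum_le_card_nsmul Finset.univ _ _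
    fun r _ => (linColength_residueBox_bounds (d := d) p n r).2
  rw [← hcard, smul_eq_mul, ← Nat.cast_le (α := ℝ)] at hlower hupper
  rw [normalizedColength, mul_assoc, div_mul_cancel₀ _ (by positivity)]
  rw [Nat.cast_mul] at hlower hupper
  rw [abs_of_nonneg (sub_nonneg.2 hlower), sub_le_iff_le_add', mul_assoc, ← mul_add]
  exact_mod_cast hupper

theorem exists_isHilbertKunzMultiplicity (hd : ∀ i, 0 < d i) :
    ∃ m : ℝ, IsHilbertKunzMultiplicity (diagonalForm p d) m ∧
      |m - (∏ i, d i : ℕ) * normalizedColength p d 1| ≤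
        (∏ i, d i : ℕ) * (2 * (t + 2 : ℕ)) / p := by
  obtain ⟨y, hy0, hy⟩ := exists_limit_normalizedColength p hd
  have hp0 : (0 : ℝ) < p := Nat.cast_pos.2 hp.out.pos
  have hD : 0 < ((∏ i, d i : ℕ) : ℝ) := Nat.cast_pos.2 (Finset.prod_pos fun i _ => hd i)
  set D := ((∏ i, d i : ℕ) : ℝ)
  refine ⟨D * y, ⟨mul_pos hD hy0, _, hkColength_diagonalForm p hd, ?_⟩, ?_⟩
  · refine Asymptotics.IsBigO.of_bound (D * (t + 2 : ℕ) + D * (2 * (t + 2 : ℕ)))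
      (Eventually.of_forall fun n => ?_)
    rw [Nat.add_sub_cancel, Real.norm_of_nonneg (pow_nonneg (pow_nonneg hp0.le n) t),
      Real.norm_eq_abs, add_mul]
    refine (abs_sub_le _ (D * normalizedColength p d n * ((p : ℝ) ^ n) ^ (t + 1)) _).trans
      (add_le_add (abs_sum_linColength_residueBox_sub_le p n) ?_)
    calc |D * normalizedColength p d n * ((p : ℝ) ^ n) ^ (t + 1) - D * y * (p ^ n) ^ (t + 1)|
        = D * |normalizedColength p d n - y| * ((p : ℝ) ^ n) ^ (t + 1) := by
          rw [← sub_mul, ← mul_sub, abs_mul, abs_mul, abs_of_pos hD,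
            abs_of_pos (pow_pos (pow_pos hp0 n) _)]
      _ ≤ D * (2 * (t + 2 : ℕ) * (p : ℝ)⁻¹ ^ n) * ((p : ℝ) ^ n) ^ (t + 1) := by
          gcongr
          exact hy n
      _ = D * (2 * (t + 2 : ℕ)) * ((p : ℝ) ^ n) ^ t := by
          rw [inv_pow, pow_succ]
          field_simp
  · rw [← mul_sub, abs_mul, abs_of_pos hD, abs_sub_comm, mul_div_assoc, div_eq_mul_inv,
      ← pow_one (p : ℝ)⁻¹]
    exact mul_le_mul_of_nonneg_left (hy 1) hD.le

end Multiplicity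

section Uniqueness

open Filter Topology

theorem eq_of_sub_mul_pow_isBigO {e : ℕ → ℝ} {m m' b : ℝ} (hb : 1 < b) {t : ℕ}
    (h : (fun n => e n - m * (b ^ n) ^ (t + 1)) =O[atTop] fun n => (b ^ n) ^ t)
    (h' : (fun n => e n - m' * (b ^ n) ^ (t + 1)) =O[atTop] fun n => (b ^ n) ^ t) : m = m' := by
  have : 0 < b := one_pos.trans hb
  have hdiff : (fun n => (m - m') * (b ^ n) ^ (t + 1)) =O[atTop] fun n => (b ^ n) ^ t :=
    (h'.sub h).congr_left fun n => by ring
  have hzero : Tendsto (fun n => (b ^ n)⁻¹) atTop (𝓝 0) :=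
    (tendsto_pow_atTop_atTop_of_one_lt hb).inv_tendsto_atTop
  have hconst : (fun _ : ℕ => m - m') =O[atTop] fun n => (b ^ n)⁻¹ :=
    (hdiff.mul (Asymptotics.isBigO_refl (fun n => ((b ^ n) ^ (t + 1))⁻¹) atTop)).congr
      (fun n => mul_inv_cancel_right₀ (by positivity) _) fun n => by
        rw [pow_succ]
        field_simp
  exact sub_eq_zero.1 (tendsto_nhds_unique tendsto_const_nhds (hconst.trans_tendsto hzero))

theorem isHilbertKunzMultiplicity_unique {p t : ℕ} (hp : 1 < p)
    {f : MvPolynomial (Fin (t + 2)) (ZMod p)} {m m' : ℝ} (h : IsHilbertKunzMultiplicity f m)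
    (h' : IsHilbertKunzMultiplicity f m') : m = m' := by
  obtain ⟨-, e, he, hO⟩ := h
  obtain ⟨-, e', he', hO'⟩ := h'
  obtain rfl : e = e' := funext fun n => Nat.cast_injective ((he n).symm.trans (he' n))
  exact eq_of_sub_mul_pow_isBigO (Nat.one_lt_cast.2 hp) hO hO'

end Uniqueness

section LargePrimes

open Filter Topology

variable {t : ℕ} {d : Fin (t + 2) → ℕ}

theorem normalizedColength_one (p : ℕ) [Fact p.Prime] :
    normalizedColength p d 1 = middleCount p (fun i => p / d i) / (p : ℝ) ^ (t + 1) := by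
  rw [normalizedColength, pow_one, pow_one,
    ← linColength_eq_middleCount (ZMod p) p fun i => Nat.div_le_self p (d i), Int.cast_natCast]

theorem existsUnique_isHilbertKunzMultiplicity (hd : ∀ i, 0 < d i) {p : ℕ} (hp : p.Prime) :
    ∃! m : ℝ, IsHilbertKunzMultiplicity (diagonalForm p d) m := by
  have : Fact p.Prime := ⟨hp⟩
  obtain ⟨m, hm, -⟩ := exists_isHilbertKunzMultiplicity p hd
  exact ⟨m, hm, fun m' hm' => isHilbertKunzMultiplicity_unique hp.one_lt hm' hm⟩

theorem abs_sub_middleCount_le (hd : ∀ i, 0 < d i) {p : ℕ} (hp : p.Prime) {m : ℝ}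
    (hm : IsHilbertKunzMultiplicity (diagonalForm p d) m) :
    |m - (∏ i, d i : ℕ) * (middleCount p (fun i => p / d i) / (p : ℝ) ^ (t + 1))| ≤
      (∏ i, d i : ℕ) * (2 * (t + 2 : ℕ)) / p := by
  have : Fact p.Prime := ⟨hp⟩
  obtain ⟨m', hm', hbound⟩ := exists_isHilbertKunzMultiplicity p hd
  rwa [isHilbertKunzMultiplicity_unique hp.one_lt hm hm', ← normalizedColength_one]

theorem tendsto_isHilbertKunzMultiplicity (hd : ∀ i, 0 < d i) {μ : ℕ → ℝ}
    (hμ : ∀ p : ℕ, p.Prime → IsHilbertKunzMultiplicity (diagonalForm p d) (μ p)) :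
    Tendsto μ (atTop ⊓ 𝓟 {p : ℕ | p.Prime}) (𝓝 ((∏ i, d i : ℕ) *
      ((2 : ℝ) ^ (1 - ((t + 2 : ℕ) : ℤ)) / (t + 1).factorial * ∑ᶠ l : ℤ, signSum d l))) := by
  refine (((tendsto_middleCount t.succ_pos d).const_mul _).mono_left inf_le_left).congr_dist
    (squeeze_zero' (Eventually.of_forall fun _ => dist_nonneg) ?_
      ((tendsto_const_div_atTop_nhds_zero_nat ((∏ i, d i : ℕ) * (2 * (t + 2 : ℕ)) : ℝ)).mono_left
        inf_le_left))
  filter_upwards [mem_inf_of_right (mem_principal_self _)] with p hp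
  rw [dist_comm, Real.dist_eq]
  exact abs_sub_middleCount_le hd hp (hμ p hp)

end LargePrimes

end DiagonalHK

theorem theorem2p4 (s : ℕ) (hs : 2 ≤ s) (d : Fin s → ℕ) (hd : ∀ i, 1 < d i) :
    (∀ p : ℕ, p.Prime → ∃! m : ℝ, IsHilbertKunzMultiplicity (diagonalForm p d) m) ∧
    (Function.support (signSum d)).Finite ∧
    (∀ μ : ℕ → ℝ,
      (∀ p : ℕ, p.Prime → IsHilbertKunzMultiplicity (diagonalForm p d) (μ p)) →
      Filter.Tendsto μ (Filter.atTop ⊓ Filter.principal {p : ℕ | p.Prime})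
        (nhds ((((∏ i, d i : ℕ) : ℝ) * (2 : ℝ) ^ (1 - (s : ℤ)) / ((s - 1).factorial : ℝ)) *
          ∑ᶠ l : ℤ, signSum d l))) ∧
    (((∏ i, d i : ℕ) : ℝ) * (2 : ℝ) ^ (1 - (s : ℤ)) / ((s - 1).factorial : ℝ)) *
        ∑ᶠ l : ℤ, signSum d l =
      (((∏ i, d i : ℕ) : ℝ) * (2 : ℝ) ^ (1 - (s : ℤ)) / ((s - 1).factorial : ℝ)) *
        (signSum d 0 + 2 * ∑ᶠ (l : ℤ) (_ : 0 < l), signSum d l) := by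
  obtain ⟨t, rfl⟩ : ∃ t, s = t + 2 := ⟨s - 2, by omega⟩
  have hd0 (i : Fin (t + 2)) : 0 < d i := zero_lt_one.trans (hd i)
  refine ⟨fun p hp => DiagonalHK.existsUnique_isHilbertKunzMultiplicity hd0 hp,
    DiagonalHK.finite_support_signSum t.succ_pos d, fun μ hμ => ?_, ?_⟩
  · rw [mul_div_assoc, mul_assoc]
    exact DiagonalHK.tendsto_isHilbertKunzMultiplicity hd0 hμ
  · rw [DiagonalHK.finsum_signSum_eq t.succ_pos d]
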